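/- Let $n\ge 1$ and let $f,g\in\mathbb{R}[x,y]$ be real polynomials of total degree at most $n$. Consider the perturbed cubic isochronous system $$\dot x=-y+x^3-xy^2+\varepsilon f(x,y),\qquad \dot y=x+x^2y-y^3+\varepsilon g(x,y).\tag{$X_\varepsilon$}$$ For $\varepsilon=0$ it has the first integral $H(x,y)=\dfrac{x^2+y^2}{1+2xy}$ with integrating factor $\mu(x,y)=\dfrac{2}{(1+2xy)^2}$, and a period annulus $\mathcal A=\bigcup_{0<h<1}\Gamma_h$ around the origin, where $\Gamma_h=\{(x,y): H(x,y)=h\}$. For $h\in(0,1)$ put $$I(h)=\oint_{\Gamma_h}\mu\,g\,dx-\mu\,f\,dy .$$ If $I$ is not identically zero on $(0,1)$, then at most $$4\left[\tfrac{n+1}{2}\right]+1$$ limit cycles of $(X_\varepsilon)$ bifurcate from the period annulus. That is, for every compact set $K\subset\mathcal A$ there is $\varepsilon_0>0$ such that for every $\varepsilon$ with $0<|\varepsilon|<\varepsilon_0$ the system $(X_\varepsilon)$ has at most $4\left[\frac{n+1}{2}\right]+1$ limit cycles contained in $K$. Here $[\cdot]$ is the integer part, and a limit cycle is a periodic orbit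 having a neighbourhood that contains no other periodic orbit. -/

import Mathlib

open Set

namespace CubicIsochronous

noncomputable section

/-- The perturbed planar vector field: the first component is the right-hand side for the
derivative of `x`, the second one the right-hand side for the derivative of `y`. -/
def field (f g : MvPolynomial (Fin 2) ℝ) (ε : ℝ) (p : ℝ × ℝ) : ℝ × ℝ :=
  (-p.2 + p.1 ^ 3 - p.1 * p.2 ^ 2 + ε * MvPolynomial.eval ![p.1, p.2] f,
    p.1 + p.1 ^ 2 * p.2 - p.2 ^ 3 + ε * MvPolynomial.eval ![p.1, p.2] g)

/-- The first integral of the unperturbed system. Where `1 + 2 * x * y = 0` it takes the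
value `0`, which is outside the range `(0, 1)` of interest. -/
def H (p : ℝ × ℝ) : ℝ := (p.1 ^ 2 + p.2 ^ 2) / (1 + 2 * p.1 * p.2)

/-- The integrating factor. -/
def mu (p : ℝ × ℝ) : ℝ := 2 / (1 + 2 * p.1 * p.2) ^ 2

/-- The oval `{H = h}`. -/
def Gamma (h : ℝ) : Set (ℝ × ℝ) := {p | H p = h}

/-- The period annulus: the union of the ovals `{H = h}` with `0 < h < 1`. -/
def periodAnnulus : Set (ℝ × ℝ) := ⋃ h ∈ Ioo (0 : ℝ) 1, Gamma h

/-- The polar radius of the oval `{H = h}` at the angle `t`. -/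
def radius (h t : ℝ) : ℝ := √(h / (1 - h * Real.sin (2 * t)))

/-- The anticlockwise parametrization, `0 ≤ t ≤ 2 * π`, of the oval `{H = h}`. -/
def curve (h t : ℝ) : ℝ × ℝ := (radius h t * Real.cos t, radius h t * Real.sin t)

/-- The Abelian integral: the line integral of `μ g dx - μ f dy` along the oval `{H = h}`. -/
def abelianIntegral (f g : MvPolynomial (Fin 2) ℝ) (h : ℝ) : ℝ :=
  ∫ t in (0 : ℝ)..(2 * Real.pi),
    (mu (curve h t) * MvPolynomial.eval ![(curve h t).1, (curve h t).2] g
        * deriv (fun s => (curve h s).1) t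
      - mu (curve h t) * MvPolynomial.eval ![(curve h t).1, (curve h t).2] f
        * deriv (fun s => (curve h s).2) t)

/-- `C` is a (nontrivial) periodic orbit of the planar vector field `X`. -/
def IsPeriodicOrbit (X : ℝ × ℝ → ℝ × ℝ) (C : Set (ℝ × ℝ)) : Prop :=
  ∃ (γ : ℝ → ℝ × ℝ) (T : ℝ), 0 < T ∧ (∀ t, HasDerivAt γ (X (γ t)) t) ∧
    Function.Periodic γ T ∧ (∃ s t, γ s ≠ γ t) ∧ C = range γ

/-- A limit cycle: a periodic orbit that is isolated among the periodic orbits. -/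
def IsLimitCycle (X : ℝ × ℝ → ℝ × ℝ) (C : Set (ℝ × ℝ)) : Prop :=
  IsPeriodicOrbit X C ∧
    ∃ U : Set (ℝ × ℝ), IsOpen U ∧ C ⊆ U ∧ ∀ C', IsPeriodicOrbit X C' → C' ⊆ U → C' = C

/-- At most `N` limit cycles of the family `X ε` bifurcate, at `ε = 0`, from the annulus `A`:
in each compact part of `A` there are at most `N` limit cycles once `ε ≠ 0` is small enough. -/
def AtMostLimitCyclesBifurcate (X : ℝ → ℝ × ℝ → ℝ × ℝ) (A : Set (ℝ × ℝ)) (N : ℕ) : Prop :=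
  ∀ K : Set (ℝ × ℝ), IsCompact K → K ⊆ A →
    ∃ ε₀ : ℝ, 0 < ε₀ ∧ ∀ ε : ℝ, 0 < |ε| → |ε| < ε₀ →
      {C : Set (ℝ × ℝ) | IsLimitCycle (X ε) C ∧ C ⊆ K}.encard ≤ N

lemma den_pos {h : ℝ} (hh : h ∈ Ioo (0 : ℝ) 1) (t : ℝ) : 0 < 1 - h * Real.sin (2 * t) := by
  have h1 := Real.sin_le_one (2 * t)
  nlinarith [hh.1, hh.2]

lemma radius_pos {h : ℝ} (hh : h ∈ Ioo (0 : ℝ) 1) (t : ℝ) : 0 < radius h t :=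
  Real.sqrt_pos.2 (div_pos hh.1 (den_pos hh t))

lemma radius_sq {h : ℝ} (hh : h ∈ Ioo (0 : ℝ) 1) (t : ℝ) :
    radius h t ^ 2 * (1 - h * Real.sin (2 * t)) = h := by
  rw [radius, Real.sq_sqrt (div_pos hh.1 (den_pos hh t)).le]
  exact div_mul_cancel₀ _ (den_pos hh t).ne'

/-- One turn of the parametrization covers the oval, and nothing else. -/
lemma image_curve {h : ℝ} (hh : h ∈ Ioo (0 : ℝ) 1) :
    curve h '' Ico 0 (2 * Real.pi) = Gamma h := by
  have key : ∀ t, curve h t ∈ Gamma h := by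
    intro t
    have h1 := radius_sq hh t
    have h2 := radius_pos hh t
    have h3 := Real.sin_sq_add_cos_sq t
    rw [Real.sin_two_mul] at h1
    have h4 : h * (1 + 2 * (radius h t * Real.cos t) * (radius h t * Real.sin t))
        = (radius h t * Real.cos t) ^ 2 + (radius h t * Real.sin t) ^ 2 := by
      linear_combination -h1 - radius h t ^ 2 * h3
    have h5 : 1 + 2 * (radius h t * Real.cos t) * (radius h t * Real.sin t) ≠ 0 := by
      intro h0
      rw [h0] at h4
      have : 0 < radius h t ^ 2 := by positivity
      nlinarith
    exact (div_eq_iff h5).2 h4.symm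
  apply Subset.antisymm
  · rintro _ ⟨t, -, rfl⟩
    exact key t
  · rintro ⟨x, y⟩ hp
    have hp : (x ^ 2 + y ^ 2) / (1 + 2 * x * y) = h := hp
    have hne : 1 + 2 * x * y ≠ 0 := by
      intro h0
      rw [h0, div_zero] at hp
      exact hh.1.ne hp
    rw [div_eq_iff hne] at hp
    have hz : (⟨x, y⟩ : ℂ) ≠ 0 := by
      intro h0
      have hx : x = 0 := congrArg Complex.re h0
      have hy : y = 0 := congrArg Complex.im h0
      subst hx hy
      have := hh.1
      norm_num at hp
      linarith
    set z : ℂ := ⟨x, y⟩ with hzdef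
    have hpos : 0 < ‖z‖ := norm_pos_iff.2 hz
    obtain ⟨t, ht, hcs⟩ : ∃ t ∈ Ico 0 (2 * Real.pi),
        Real.cos t = Real.cos z.arg ∧ Real.sin t = Real.sin z.arg := by
      rcases lt_or_ge z.arg 0 with h0 | h0
      · exact ⟨z.arg + 2 * Real.pi, ⟨by linarith [Complex.neg_pi_lt_arg z, Real.pi_pos],
          by linarith⟩, Real.cos_add_two_pi _, Real.sin_add_two_pi _⟩
      · exact ⟨z.arg, ⟨h0, by linarith [Complex.arg_le_pi z, Real.pi_pos]⟩, rfl, rfl⟩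
    have hx : ‖z‖ * Real.cos t = x := by rw [hcs.1, Complex.norm_mul_cos_arg]
    have hy : ‖z‖ * Real.sin t = y := by rw [hcs.2, Complex.norm_mul_sin_arg]
    have hr : radius h t = ‖z‖ := by
      have h1 := radius_sq hh t
      have h3 := Real.sin_sq_add_cos_sq t
      have h2 : ‖z‖ ^ 2 * (1 - h * Real.sin (2 * t)) = h := by
        rw [Real.sin_two_mul]
        rw [← hx, ← hy] at hp
        linear_combination hp - ‖z‖ ^ 2 * h3
      have h4 : radius h t ^ 2 = ‖z‖ ^ 2 :=
        mul_right_cancel₀ (den_pos hh t).ne' (h1.trans h2.symm)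
      exact (pow_left_inj₀ (radius_pos hh t).le hpos.le two_ne_zero).1 h4
    exact ⟨t, ht, Prod.ext (by simp only [curve, hr, hx]) (by simp only [curve, hr, hy])⟩

/-- The parametrization is a solution of the unperturbed system; in particular it is
differentiable, and it runs in the direction of the flow. -/
lemma hasDerivAt_curve {h : ℝ} (hh : h ∈ Ioo (0 : ℝ) 1) (t : ℝ) :
    HasDerivAt (curve h) (field 0 0 0 (curve h t)) t := by
  have hd := den_pos hh t
  have h1 : HasDerivAt (fun s => h / (1 - h * Real.sin (2 * s)))
      (2 * radius h t ^ 4 * Real.cos (2 * t)) t := by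
    have ha : HasDerivAt (fun s : ℝ => 2 * s) 2 t := by
      simpa using (hasDerivAt_id t).const_mul 2
    have hb := ((ha.sin.const_mul h).const_sub 1)
    have hc := (hasDerivAt_const t h).div hb hd.ne'
    refine hc.congr_deriv ?_
    have h4 : radius h t ^ 4 = (h / (1 - h * Real.sin (2 * t))) ^ 2 := by
      rw [radius, show (4 : ℕ) = 2 * 2 from rfl, pow_mul,
        Real.sq_sqrt (div_pos hh.1 hd).le]
    rw [h4]
    field_simp
    ring
  have h2 : HasDerivAt (radius h) (radius h t ^ 3 * Real.cos (2 * t)) t := by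
    refine (h1.sqrt (div_pos hh.1 hd).ne').congr_deriv ?_
    change _ / (2 * radius h t) = _
    have := (radius_pos hh t).ne'
    field_simp
  refine ((h2.mul (Real.hasDerivAt_cos t)).prodMk
    (h2.mul (Real.hasDerivAt_sin t))).congr_deriv ?_
  have h5 := Real.cos_sq' t
  apply Prod.ext
  · simp only [field, curve, Real.cos_two_mul, map_zero, mul_zero, add_zero]
    linear_combination (radius h t ^ 3 * Real.cos t) * h5
  · simp only [field, curve, Real.cos_two_mul, map_zero, mul_zero, add_zero]
    linear_combination (radius h t ^ 3 * Real.sin t) * h5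

end

end CubicIsochronous

/-!
The system is integrable for `ε = 0`, with first integral `H`, and `1 / H` is the convenient
coordinate: for `w = 1 / H = r⁻² + sin 2θ` and the polar angle `θ` the unperturbed system is
`θ' = 1`, `w' = 0`. The perturbed system becomes `θ' = 1 + ε A(θ, w)`, `w' = ε B(θ, w)`
(`angularPart`, `radialPart`), so that the periodic orbits in a compact part of the annulus are, for
small `ε`, the graphs of the `2π`-periodic solutions of `dw/dθ = ε B / (1 + ε A)`
(`exists_graph_of_isPeriodicOrbit`, `eq_of_return`), and they are determined by their initial
values.

*Averaging.* The increment of a solution over one turn, divided by `ε`, extends holomorphically in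
the initial value to a complex neighbourhood of the relevant interval that does not depend on `ε`,
and converges uniformly there to `M(w) = ∫ B(θ, w) dθ` as `ε → 0`
(`exists_holomorphic_increment`, `exists_averaging`). The Picard iterates are holomorphic, and they
converge uniformly since `ε` is small. For holomorphic functions uniform convergence controls zeros
with their multiplicities: if there were `m` periodic orbits for a sequence `ε → 0`, the limits of
their initial values would be `m` zeros of `M`, counted with multiplicity
(`exists_eq_prod_mul_of_tendsto_zeros`).

*Zeros of the Abelian integral.* Since `I(h) = h² M(1 / h)` (`abelianIntegral_eq`), the function `M`
is not identically zero. With `J = [(n + 1) / 2]`, the function `(w² - 1)^(J - 1) M(w)` has the form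
`A(w) + Q(w) √(w² - 1)` with polynomials of degrees at most `2 J` and less than `2 J`
(`isSqrtPoly_integral_radialPart`): expanding in monomials and using the symmetries
`θ ↦ θ + π` and `θ ↦ π/2 - θ` leaves the integrals of `(sin 2θ)^i (w - sin 2θ)^(-k)`, which are
computed recursively from the Poisson kernel. Zeros of `A + Q √(w² - 1)` are zeros of the nonzero
polynomial `A² - Q² (w² - 1)`, whose degree is at most `4 J` (`IsSqrtPoly.card_zeros_le`).
-/

/-! ### Integrals of trigonometric functions over a turn -/

namespace CubicIsochronous

open Polynomial intervalIntegral

lemma sub_sin_pos {w : ℝ} (hw : 1 < w) (t : ℝ) : 0 < w - Real.sin (2 * t) := by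
  linarith [Real.sin_le_one (2 * t)]

/-- `F` is on `(1, ∞)` of the form `A + Q √(w² - 1)` with polynomials `A` of degree at most `d`
and `Q` of degree less than `d`. -/
def IsSqrtPoly (d : ℕ) (F : ℝ → ℝ) : Prop :=
  ∃ A ∈ degreeLT ℝ (d + 1), ∃ Q ∈ degreeLT ℝ d,
    ∀ w, 1 < w → F w = A.eval w + Q.eval w * √(w ^ 2 - 1)

namespace IsSqrtPoly

variable {d e : ℕ} {F G : ℝ → ℝ}

lemma congr (hF : IsSqrtPoly d F) (h : ∀ w, 1 < w → G w = F w) : IsSqrtPoly d G := by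
  obtain ⟨A, hA, Q, hQ, hFe⟩ := hF
  exact ⟨A, hA, Q, hQ, fun w hw => by rw [h w hw, hFe w hw]⟩

lemma mono (hF : IsSqrtPoly d F) (h : d ≤ e) : IsSqrtPoly e F := by
  obtain ⟨A, hA, Q, hQ, hFe⟩ := hF
  exact ⟨A, degreeLT_mono (by omega) hA, Q, degreeLT_mono h hQ, hFe⟩

lemma add (hF : IsSqrtPoly d F) (hG : IsSqrtPoly d G) : IsSqrtPoly d (fun w => F w + G w) := by
  obtain ⟨A, hA, Q, hQ, hFe⟩ := hF
  obtain ⟨A', hA', Q', hQ', hGe⟩ := hG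
  refine ⟨A + A', Submodule.add_mem _ hA hA', Q + Q', Submodule.add_mem _ hQ hQ',
    fun w hw => ?_⟩
  simp only [hFe w hw, hGe w hw, eval_add]
  ring

lemma const_mul (c : ℝ) (hF : IsSqrtPoly d F) : IsSqrtPoly d (fun w => c * F w) := by
  obtain ⟨A, hA, Q, hQ, hFe⟩ := hF
  refine ⟨c • A, Submodule.smul_mem _ _ hA, c • Q, Submodule.smul_mem _ _ hQ, fun w hw => ?_⟩
  simp only [hFe w hw, eval_smul, smul_eq_mul]
  ring

lemma sub (hF : IsSqrtPoly d F) (hG : IsSqrtPoly d G) : IsSqrtPoly d (fun w => F w - G w) :=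
  (hF.add (hG.const_mul (-1))).congr fun w _ => by ring

lemma zero (d : ℕ) : IsSqrtPoly d (fun _ => 0) :=
  ⟨0, Submodule.zero_mem _, 0, Submodule.zero_mem _, fun w _ => by simp⟩

lemma sum {ι : Type*} (s : Finset ι) {F : ι → ℝ → ℝ} (h : ∀ i ∈ s, IsSqrtPoly d (F i)) :
    IsSqrtPoly d (fun w => ∑ i ∈ s, F i w) := by
  classical
  induction s using Finset.induction_on with
  | empty => simpa using zero d
  | insert a s ha ih =>
    simp only [Finset.sum_insert ha]
    exact (h a (by simp)).add (ih fun i hi => h i (by simp [hi]))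

lemma const (c : ℝ) : IsSqrtPoly d (fun _ => c) :=
  ⟨C c, mem_degreeLT.2 (degree_C_le.trans_lt (by exact_mod_cast Nat.succ_pos d)), 0,
    Submodule.zero_mem _, fun w _ => by simp⟩

lemma X_mul_mem_degreeLT {d : ℕ} {A : ℝ[X]} (hA : A ∈ degreeLT ℝ d) :
    X * A ∈ degreeLT ℝ (d + 1) := by
  rcases eq_or_ne A 0 with rfl | h0
  · simp
  · rw [mem_degreeLT, ← natDegree_lt_iff_degree_lt h0] at hA
    rw [mem_degreeLT, ← natDegree_lt_iff_degree_lt (mul_ne_zero X_ne_zero h0),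
      natDegree_X_mul h0]
    omega

lemma id_mul (hF : IsSqrtPoly d F) : IsSqrtPoly (d + 1) (fun w => w * F w) := by
  obtain ⟨A, hA, Q, hQ, hFe⟩ := hF
  refine ⟨X * A, X_mul_mem_degreeLT hA, X * Q, X_mul_mem_degreeLT hQ, fun w hw => ?_⟩
  simp only [hFe w hw, eval_mul, eval_X]
  ring

lemma sq_sub_one_mul (hF : IsSqrtPoly d F) :
    IsSqrtPoly (d + 2) (fun w => (w ^ 2 - 1) * F w) :=
  ((hF.id_mul.id_mul).sub (hF.mono (Nat.le_add_right d 2))).congr fun w _ => by ring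

lemma sq_sub_one_pow_mul (hF : IsSqrtPoly d F) (k : ℕ) :
    IsSqrtPoly (d + 2 * k) (fun w => (w ^ 2 - 1) ^ k * F w) := by
  induction k with
  | zero => simpa using hF
  | succ k ih => exact ih.sq_sub_one_mul.congr fun w _ => by ring

end IsSqrtPoly

/-- The integral of `(sin 2θ)^i (w - sin 2θ)^{-k}` over a turn. -/
noncomputable def sinIntegral (i k : ℕ) (w : ℝ) : ℝ :=
  ∫ t in (0 : ℝ)..(2 * Real.pi), Real.sin (2 * t) ^ i * ((w - Real.sin (2 * t)) ^ k)⁻¹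

lemma continuous_sin_pow_mul {w : ℝ} (hw : 1 < w) (i k : ℕ) :
    Continuous fun t : ℝ => Real.sin (2 * t) ^ i * ((w - Real.sin (2 * t)) ^ k)⁻¹ := by
  have h : ∀ t : ℝ, (w - Real.sin (2 * t)) ^ k ≠ 0 := fun t => (pow_pos (sub_sin_pos hw t) k).ne'
  fun_prop (disch := assumption)

/-- The Poisson kernel has the elementary antiderivative `θ - arctan (ρ cos 2θ / (1 - ρ sin 2θ))`,
where `ρ = w - √(w² - 1)`. -/
lemma sinIntegral_zero_one {w : ℝ} (hw : 1 < w) :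
    √(w ^ 2 - 1) * sinIntegral 0 1 w = 2 * Real.pi := by
  set q := √(w ^ 2 - 1) with hq
  have hq2 : q ^ 2 = w ^ 2 - 1 := Real.sq_sqrt (by nlinarith)
  have hq0 : 0 < q := Real.sqrt_pos.2 (by nlinarith)
  set r := w - q with hr
  have hr0 : 0 < r := by nlinarith
  have hr1 : r < 1 := by nlinarith
  have hD : ∀ t : ℝ, 0 < 1 - r * Real.sin (2 * t) := fun t => by
    nlinarith [Real.sin_le_one (2 * t)]
  have key : ∀ t : ℝ, HasDerivAt
      (fun t => t - Real.arctan (r * Real.cos (2 * t) / (1 - r * Real.sin (2 * t))))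
      (q * (Real.sin (2 * t) ^ 0 * ((w - Real.sin (2 * t)) ^ 1)⁻¹)) t := by
    intro t
    have ha : HasDerivAt (fun s : ℝ => 2 * s) 2 t := by
      simpa using (hasDerivAt_id t).const_mul 2
    have h1 := (ha.cos.const_mul r).div ((ha.sin.const_mul r).const_sub 1) (hD t).ne'
    refine ((hasDerivAt_id t).sub h1.arctan).congr_deriv ?_
    have h2 := Real.sin_sq_add_cos_sq (2 * t)
    have h3 := sub_sin_pos hw t
    have h4 := hD t
    set s := Real.sin (2 * t)
    set c := Real.cos (2 * t)
    have h5 : 0 < (1 - r * s) ^ 2 + r ^ 2 * c ^ 2 := by positivity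
    have h6 : (1 - r * s) ^ 2 + r ^ 2 * c ^ 2 = 2 * r * (w - s) := by
      have : r ^ 2 + 1 = 2 * r * w := by rw [hr]; linear_combination hq2
      linear_combination r ^ 2 * h2 + this
    have h7 : 1 + (r * c / (1 - r * s)) ^ 2 = 2 * r * (w - s) / (1 - r * s) ^ 2 := by
      rw [← h6]; field_simp
    simp only [Pi.div_apply]
    rw [h7]
    field_simp
    linear_combination (-r) * h2 - hr
  have h1 := integral_eq_sub_of_hasDerivAt (a := 0) (b := 2 * Real.pi) (fun t _ => key t)
    (((continuous_sin_pow_mul hw 0 1).const_mul q).intervalIntegrable _ _)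
  rw [integral_const_mul] at h1
  rw [sinIntegral, h1]
  have h2 : (2 : ℝ) * (2 * Real.pi) = 2 * Real.pi + 2 * Real.pi := by ring
  simp [h2]

/-- Integration by parts of `cos 2θ (w - sin 2θ)^{-k}`. -/
lemma sinIntegral_zero_rec {w : ℝ} (hw : 1 < w) (k : ℕ) :
    ((k : ℝ) + 1) * ((w ^ 2 - 1) * sinIntegral 0 (k + 2) w)
      = (2 * k + 1) * (w * sinIntegral 0 (k + 1) w) - k * sinIntegral 0 k w := by
  have key : ∀ t : ℝ, HasDerivAt
      (fun t => Real.cos (2 * t) * ((w - Real.sin (2 * t)) ^ (k + 1))⁻¹)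
      (2 * (((2 * k + 1) * w) * (Real.sin (2 * t) ^ 0 * ((w - Real.sin (2 * t)) ^ (k + 1))⁻¹)
        - k * (Real.sin (2 * t) ^ 0 * ((w - Real.sin (2 * t)) ^ k)⁻¹)
        - ((k + 1) * (w ^ 2 - 1))
          * (Real.sin (2 * t) ^ 0 * ((w - Real.sin (2 * t)) ^ (k + 2))⁻¹))) t := by
    intro t
    have ha : HasDerivAt (fun s : ℝ => 2 * s) 2 t := by
      simpa using (hasDerivAt_id t).const_mul 2
    have h3 := sub_sin_pos hw t
    have h1 := ha.cos.mul (((ha.sin.const_sub w).pow (k + 1)).inv (pow_pos h3 _).ne')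
    refine h1.congr_deriv ?_
    have h2 := Real.cos_sq' (2 * t)
    simp only [Pi.inv_apply, Pi.pow_apply, Nat.add_sub_cancel]
    set s := Real.sin (2 * t)
    set c := Real.cos (2 * t)
    have h4 := h3.ne'
    obtain ⟨u, hu⟩ : ∃ u, u = w - s := ⟨_, rfl⟩
    rw [← hu] at h3 h4 ⊢
    have hs : s = w - u := by rw [hu]; ring
    rw [hs] at h2 ⊢
    push_cast
    field_simp
    ring_nf
    simp only [h2]
    ring
  have hi := fun j => (continuous_sin_pow_mul hw 0 j).intervalIntegrable (μ := MeasureTheory.volume)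
    0 (2 * Real.pi)
  have h1 := integral_eq_sub_of_hasDerivAt (a := 0) (b := 2 * Real.pi) (fun t _ => key t)
    (((((hi (k + 1)).const_mul _).sub ((hi k).const_mul _)).sub
      ((hi (k + 2)).const_mul _)).const_mul _)
  rw [integral_const_mul, integral_sub (((hi (k + 1)).const_mul _).sub ((hi k).const_mul _))
    ((hi (k + 2)).const_mul _), integral_sub ((hi (k + 1)).const_mul _) ((hi k).const_mul _),
    integral_const_mul, integral_const_mul, integral_const_mul] at h1
  have h2 : (2 : ℝ) * (2 * Real.pi) = 2 * Real.pi + 2 * Real.pi := by ring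
  simp only [h2, Real.sin_add_two_pi, Real.cos_add_two_pi, mul_zero, Real.sin_zero,
    Real.cos_zero, Real.sin_two_pi, Real.cos_two_pi, sub_self] at h1
  simp only [sinIntegral]
  linarith

lemma isSqrtPoly_sinIntegral_zero (k : ℕ) :
    IsSqrtPoly k (fun w => (w ^ 2 - 1) ^ k * sinIntegral 0 k w) := by
  induction k using Nat.strong_induction_on with
  | _ k ih =>
    match k with
    | 0 => simpa [sinIntegral] using IsSqrtPoly.const (2 * Real.pi)
    | 1 =>
      refine ⟨0, Submodule.zero_mem _, C (2 * Real.pi), ?_, fun w hw => ?_⟩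
      · exact mem_degreeLT.2 (degree_C_le.trans_lt (by norm_num))
      · have h1 : √(w ^ 2 - 1) ^ 2 = w ^ 2 - 1 := Real.sq_sqrt (by nlinarith)
        have h2 := sinIntegral_zero_one hw
        simp only [eval_zero, eval_C, zero_add, pow_one]
        linear_combination √(w ^ 2 - 1) * h2 - sinIntegral 0 1 w * h1
    | k + 2 =>
      have h1 := ((ih (k + 1) (by omega)).id_mul).const_mul (2 * (k : ℝ) + 1)
      have h2 := ((ih k (by omega)).sq_sub_one_mul).const_mul (k : ℝ)
      refine ((h1.sub h2).const_mul ((k : ℝ) + 1)⁻¹).congr fun w hw => ?_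
      have h3 := sinIntegral_zero_rec hw k
      have h4 : (k : ℝ) + 1 ≠ 0 := by positivity
      field_simp
      linear_combination (w ^ 2 - 1) ^ (k + 1) * h3

lemma sinIntegral_succ {w : ℝ} (hw : 1 < w) (i k : ℕ) :
    sinIntegral (i + 1) (k + 1) w = w * sinIntegral i (k + 1) w - sinIntegral i k w := by
  have hi := fun j => (continuous_sin_pow_mul hw i j).intervalIntegrable
    (μ := MeasureTheory.volume) 0 (2 * Real.pi)
  simp only [sinIntegral]
  rw [← integral_const_mul, ← integral_sub ((hi _).const_mul _) (hi _)]
  refine integral_congr fun t _ => ?_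
  have h3 := (sub_sin_pos hw t).ne'
  field_simp
  ring

lemma isSqrtPoly_sinIntegral (i k : ℕ) :
    IsSqrtPoly (i + k) (fun w => (w ^ 2 - 1) ^ k * sinIntegral i k w) := by
  induction i generalizing k with
  | zero => simpa using isSqrtPoly_sinIntegral_zero k
  | succ i ih =>
    cases k with
    | zero => simpa [sinIntegral] using IsSqrtPoly.const _
    | succ k =>
      have h1 := (ih (k + 1)).id_mul.mono (show i + (k + 1) + 1 ≤ i + 1 + (k + 1) by omega)
      have h2 := (ih k).sq_sub_one_mul.mono (show i + k + 2 ≤ i + 1 + (k + 1) by omega)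
      refine (h1.sub h2).congr fun w hw => ?_
      rw [sinIntegral_succ hw]
      ring

lemma isSqrtPoly_integral_eval (p : ℝ[X]) {m : ℕ} (hp : p.natDegree ≤ m) (k : ℕ) :
    IsSqrtPoly (m + k) (fun w => (w ^ 2 - 1) ^ k * ∫ t in (0 : ℝ)..(2 * Real.pi),
      p.eval (Real.sin (2 * t)) * ((w - Real.sin (2 * t)) ^ k)⁻¹) := by
  have h1 : ∀ i ∈ Finset.range (m + 1), IsSqrtPoly (m + k)
      (fun w => p.coeff i * ((w ^ 2 - 1) ^ k * sinIntegral i k w)) := fun i hi =>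
    ((isSqrtPoly_sinIntegral i k).const_mul _).mono (by have := Finset.mem_range.1 hi; omega)
  refine (IsSqrtPoly.sum _ h1).congr fun w hw => ?_
  have h2 : ∀ t : ℝ, p.eval (Real.sin (2 * t)) * ((w - Real.sin (2 * t)) ^ k)⁻¹
      = ∑ i ∈ Finset.range (m + 1),
        p.coeff i * (Real.sin (2 * t) ^ i * ((w - Real.sin (2 * t)) ^ k)⁻¹) := fun t => by
    rw [eval_eq_sum_range' (Nat.lt_succ_of_le hp), Finset.sum_mul]
    exact Finset.sum_congr rfl fun i _ => by ring
  simp only [h2]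
  rw [integral_finsetSum fun i _ =>
    ((continuous_sin_pow_mul hw i k).intervalIntegrable _ _).const_mul _, Finset.mul_sum]
  refine Finset.sum_congr rfl fun i _ => ?_
  rw [integral_const_mul, sinIntegral]
  ring

/-- The symmetric trigonometric polynomial is a polynomial in `sin 2θ`, by Newton's identities
for the power sums of `cos² θ` and `sin² θ`. -/
lemma exists_eval_sin_eq (a b m : ℕ) (h : a + b = 2 * m) :
    ∃ p : ℝ[X], p.natDegree ≤ m ∧ ∀ t : ℝ,
      Real.cos t ^ a * Real.sin t ^ b + Real.cos t ^ b * Real.sin t ^ a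
        = p.eval (Real.sin (2 * t)) := by
  have key : ∀ e : ℕ, (∃ p : ℝ[X], p.natDegree ≤ e ∧ ∀ t : ℝ,
      Real.cos t ^ (2 * e) + Real.sin t ^ (2 * e) = p.eval (Real.sin (2 * t))) ∧
      (∃ p : ℝ[X], p.natDegree ≤ e + 1 ∧ ∀ t : ℝ,
      Real.cos t ^ (2 * (e + 1)) + Real.sin t ^ (2 * (e + 1)) = p.eval (Real.sin (2 * t))) := by
    intro e
    induction e with
    | zero =>
      refine ⟨⟨C 2, by simp, fun t => by simp; norm_num⟩, ⟨C 1, by simp, fun t => ?_⟩⟩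
      simp only [eval_C]
      linear_combination Real.sin_sq_add_cos_sq t
    | succ e ih =>
      refine ⟨ih.2, ?_⟩
      obtain ⟨⟨p, hp, hpe⟩, ⟨q, hq, hqe⟩⟩ := ih
      refine ⟨q - C (1 / 4) * X ^ 2 * p, ?_, fun t => ?_⟩
      · refine (natDegree_sub_le _ _).trans (max_le (by omega) ?_)
        refine natDegree_mul_le.trans ?_
        have := natDegree_C_mul_X_pow_le (1 / 4 : ℝ) 2
        omega
      · simp only [eval_sub, eval_mul, eval_C, eval_pow, eval_X]
        rw [← hpe, ← hqe, Real.sin_two_mul]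
        have := Real.sin_sq_add_cos_sq t
        linear_combination (Real.cos t ^ (2 * (e + 1)) + Real.sin t ^ (2 * (e + 1))) * this
  wlog hab : b ≤ a generalizing a b
  · obtain ⟨p, hp, h⟩ := this b a (by omega) (by omega)
    exact ⟨p, hp, fun t => by rw [add_comm, h]⟩
  obtain ⟨e, rfl⟩ : ∃ e, a = b + 2 * e := ⟨(a - b) / 2, by omega⟩
  obtain ⟨p, hp, hpe⟩ := (key e).1
  refine ⟨(C (1 / 2) * X) ^ b * p, ?_, fun t => ?_⟩
  · refine natDegree_mul_le.trans ?_
    have h1 : (C (1 / 2 : ℝ) * X).natDegree ≤ 1 := natDegree_C_mul_le _ _ |>.trans natDegree_X_le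
    have h2 := natDegree_pow_le_of_le b h1
    omega
  · simp only [eval_mul, eval_C, eval_pow, eval_X]
    rw [← hpe, Real.sin_two_mul,
      show 1 / 2 * (2 * Real.sin t * Real.cos t) = Real.sin t * Real.cos t by ring]
    ring

/-- Substituting `θ ↦ π/2 - θ` in an integral over a full turn. -/
lemma integral_pi_div_two_sub {h : ℝ → ℝ} (hp : Function.Periodic h (2 * Real.pi)) :
    ∫ t in (0 : ℝ)..(2 * Real.pi), h (Real.pi / 2 - t) = ∫ t in (0 : ℝ)..(2 * Real.pi), h t := by
  rw [integral_comp_sub_left]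
  have := hp.intervalIntegral_add_eq (Real.pi / 2 - 2 * Real.pi) 0
  simpa using this

lemma integral_eq_zero_of_antiperiodic {h : ℝ → ℝ} (hp : ∀ t, h (t + Real.pi) = - h t) :
    ∫ t in (0 : ℝ)..(2 * Real.pi), h t = 0 := by
  have hp2 : Function.Periodic h (2 * Real.pi) := fun t => by
    rw [two_mul, ← add_assoc, hp, hp, neg_neg]
  have h1 : ∫ t in (0 : ℝ)..(2 * Real.pi), h (t + Real.pi)
      = ∫ t in (0 : ℝ)..(2 * Real.pi), h t := by
    rw [integral_comp_add_right]
    have := hp2.intervalIntegral_add_eq Real.pi 0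
    simpa [add_comm] using this
  simp only [hp, integral_neg] at h1
  linarith

/-- By the symmetry `θ ↦ π/2 - θ` the monomial `cos^a θ sin^b θ` may be replaced by half of
`cos^a θ sin^b θ + cos^b θ sin^a θ`, which is a polynomial in `sin 2θ`. -/
lemma isSqrtPoly_integral_trig (a b k : ℕ) (h : a + b = 2 * (k + 1)) :
    IsSqrtPoly (2 * k + 1) (fun w => (w ^ 2 - 1) ^ k * ∫ t in (0 : ℝ)..(2 * Real.pi),
      Real.cos t ^ a * Real.sin t ^ b * ((w - Real.sin (2 * t)) ^ k)⁻¹) := by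
  obtain ⟨p, hp, hpe⟩ := exists_eval_sin_eq a b (k + 1) h
  refine (((isSqrtPoly_integral_eval p hp k).const_mul (1 / 2)).mono (by omega)).congr
    fun w hw => ?_
  have hc : ∀ a b : ℕ, Continuous fun t : ℝ =>
      Real.cos t ^ a * Real.sin t ^ b * ((w - Real.sin (2 * t)) ^ k)⁻¹ := fun a b => by
    have h : ∀ t : ℝ, (w - Real.sin (2 * t)) ^ k ≠ 0 := fun t => (pow_pos (sub_sin_pos hw t) k).ne'
    fun_prop (disch := assumption)
  have h1 : ∫ t in (0 : ℝ)..(2 * Real.pi),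
        Real.cos t ^ b * Real.sin t ^ a * ((w - Real.sin (2 * t)) ^ k)⁻¹
      = ∫ t in (0 : ℝ)..(2 * Real.pi),
        Real.cos t ^ a * Real.sin t ^ b * ((w - Real.sin (2 * t)) ^ k)⁻¹ := by
    have hper : Function.Periodic (fun t : ℝ =>
        Real.cos t ^ a * Real.sin t ^ b * ((w - Real.sin (2 * t)) ^ k)⁻¹) (2 * Real.pi) := by
      intro t
      simp only [Real.cos_add_two_pi, Real.sin_add_two_pi]
      rw [show 2 * (t + 2 * Real.pi) = 2 * t + 2 * Real.pi + 2 * Real.pi by ring,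
        Real.sin_add_two_pi, Real.sin_add_two_pi]
    rw [← integral_pi_div_two_sub hper]
    refine integral_congr fun t _ => ?_
    simp only [Real.cos_pi_div_two_sub, Real.sin_pi_div_two_sub]
    rw [show 2 * (Real.pi / 2 - t) = Real.pi - 2 * t by ring, Real.sin_pi_sub]
    ring
  have h2 : ∫ t in (0 : ℝ)..(2 * Real.pi),
      p.eval (Real.sin (2 * t)) * ((w - Real.sin (2 * t)) ^ k)⁻¹
      = 2 * ∫ t in (0 : ℝ)..(2 * Real.pi),
        Real.cos t ^ a * Real.sin t ^ b * ((w - Real.sin (2 * t)) ^ k)⁻¹ := by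
    simp only [← hpe, add_mul]
    rw [integral_add ((hc _ _).intervalIntegrable _ _) ((hc _ _).intervalIntegrable _ _), h1]
    ring
  rw [h2]
  ring

end CubicIsochronous

/-! ### The averaged function and the Abelian integral -/

namespace CubicIsochronous

open Polynomial intervalIntegral

/-- The polar radius at the angle `t` on the oval `{H = 1 / w}`. -/
noncomputable def polarRadius (w t : ℝ) : ℝ := √(1 / (w - Real.sin (2 * t)))

/-- The point with polar angle `t` on the oval `{H = 1 / w}`. -/
noncomputable def polarPoint (w t : ℝ) : ℝ × ℝ :=
  (polarRadius w t * Real.cos t, polarRadius w t * Real.sin t)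

lemma polarRadius_pos {w : ℝ} (hw : 1 < w) (t : ℝ) : 0 < polarRadius w t :=
  Real.sqrt_pos.2 (one_div_pos.2 (sub_sin_pos hw t))

lemma polarRadius_sq {w : ℝ} (hw : 1 < w) (t : ℝ) :
    polarRadius w t ^ 2 = (w - Real.sin (2 * t))⁻¹ := by
  rw [polarRadius, Real.sq_sqrt (one_div_pos.2 (sub_sin_pos hw t)).le, one_div]

lemma continuous_polarRadius {w : ℝ} (hw : 1 < w) : Continuous (polarRadius w) := by
  have h : ∀ t : ℝ, w - Real.sin (2 * t) ≠ 0 := fun t => (sub_sin_pos hw t).ne'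
  unfold polarRadius
  fun_prop (disch := assumption)

/-- The part of order `ε` of the angular velocity of the perturbed system. -/
noncomputable def angularPart (f g : MvPolynomial (Fin 2) ℝ) (t w : ℝ) : ℝ :=
  (w - Real.sin (2 * t)) *
    ((polarPoint w t).1 * MvPolynomial.eval ![(polarPoint w t).1, (polarPoint w t).2] g
      - (polarPoint w t).2 * MvPolynomial.eval ![(polarPoint w t).1, (polarPoint w t).2] f)

/-- The velocity of `1 / H` along the perturbed system, divided by `ε`. -/
noncomputable def radialPart (f g : MvPolynomial (Fin 2) ℝ) (t w : ℝ) : ℝ :=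
  2 * (w - Real.sin (2 * t)) *
    (((polarPoint w t).2 - w * (polarPoint w t).1)
        * MvPolynomial.eval ![(polarPoint w t).1, (polarPoint w t).2] f
      + ((polarPoint w t).1 - w * (polarPoint w t).2)
        * MvPolynomial.eval ![(polarPoint w t).1, (polarPoint w t).2] g)

/-- The integral of `(w - sin 2θ) x^a y^b` along the oval `{H = 1 / w}`. -/
noncomputable def monomialIntegral (a b : ℕ) (w : ℝ) : ℝ :=
  ∫ t in (0 : ℝ)..(2 * Real.pi),
    (w - Real.sin (2 * t)) * ((polarPoint w t).1 ^ a * (polarPoint w t).2 ^ b)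

lemma continuous_monomial {w : ℝ} (hw : 1 < w) (a b : ℕ) : Continuous fun t : ℝ =>
    (w - Real.sin (2 * t)) * ((polarPoint w t).1 ^ a * (polarPoint w t).2 ^ b) := by
  have := continuous_polarRadius hw
  unfold polarPoint
  fun_prop

/-- The integrand changes sign under `θ ↦ θ + π`. -/
lemma monomialIntegral_of_odd {a b : ℕ} (h : Odd (a + b)) (w : ℝ) :
    monomialIntegral a b w = 0 := by
  refine integral_eq_zero_of_antiperiodic fun t => ?_
  have h1 : Real.sin (2 * (t + Real.pi)) = Real.sin (2 * t) := by
    rw [show 2 * (t + Real.pi) = 2 * t + 2 * Real.pi by ring, Real.sin_add_two_pi]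
  simp only [polarPoint, polarRadius, h1, Real.cos_add_pi, Real.sin_add_pi]
  have h2 : (-1 : ℝ) ^ a * (-1) ^ b = -1 := by rw [← pow_add]; exact h.neg_one_pow
  rw [mul_neg, mul_neg, neg_pow, neg_pow (√_ * _)]
  linear_combination (w - Real.sin (2 * t)) *
    ((√(1 / (w - Real.sin (2 * t))) * Real.cos t) ^ a
      * (√(1 / (w - Real.sin (2 * t))) * Real.sin t) ^ b) * h2

lemma isSqrtPoly_monomialIntegral (a b k : ℕ) (h : a + b = 2 * (k + 1)) :
    IsSqrtPoly (2 * k + 1) (fun w => (w ^ 2 - 1) ^ k * monomialIntegral a b w) := by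
  refine (isSqrtPoly_integral_trig a b k h).congr fun w hw => ?_
  congr 1
  refine integral_congr fun t _ => ?_
  have h1 := (sub_sin_pos hw t).ne'
  have h2 : polarRadius w t ^ (a + b) = ((w - Real.sin (2 * t)) ^ (k + 1))⁻¹ := by
    rw [h, pow_mul, polarRadius_sq hw, inv_pow]
  have h3 : (w - Real.sin (2 * t)) * ((w - Real.sin (2 * t)) ^ (k + 1))⁻¹
      = ((w - Real.sin (2 * t)) ^ k)⁻¹ := by
    rw [pow_succ]; field_simp
  simp only [polarPoint]
  rw [← h3, ← h2]
  ring

lemma isSqrtPoly_monomialIntegral_of_le {a b J : ℕ} (h0 : 1 ≤ a + b) (h : a + b ≤ 2 * J + 1) :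
    IsSqrtPoly (2 * J - 1) (fun w => (w ^ 2 - 1) ^ (J - 1) * monomialIntegral a b w) := by
  rcases Nat.even_or_odd (a + b) with ⟨k, hk⟩ | ho
  · have h1 := (isSqrtPoly_monomialIntegral a b (k - 1) (by omega)).sq_sub_one_pow_mul (J - k)
    refine (h1.mono (by omega)).congr fun w _ => ?_
    rw [← mul_assoc, ← pow_add, show J - k + (k - 1) = J - 1 by omega]
  · simpa [monomialIntegral_of_odd ho] using IsSqrtPoly.zero (2 * J - 1)

lemma eval_eq_sum (f : MvPolynomial (Fin 2) ℝ) (x y : ℝ) :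
    MvPolynomial.eval ![x, y] f = ∑ d ∈ f.support, f.coeff d * (x ^ d 0 * y ^ d 1) := by
  rw [MvPolynomial.eval_eq']
  simp [Fin.prod_univ_two]

/-- Up to the factor `(w² - 1) ^ (J - 1)` the averaged function has the form `A + Q √(w² - 1)`. -/
lemma isSqrtPoly_integral_radialPart {n J : ℕ} (f g : MvPolynomial (Fin 2) ℝ)
    (hf : f.totalDegree ≤ n) (hg : g.totalDegree ≤ n) (hJ : 1 ≤ J) (hn : n ≤ 2 * J) :
    IsSqrtPoly (2 * J) (fun w => (w ^ 2 - 1) ^ (J - 1) *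
      ∫ t in (0 : ℝ)..(2 * Real.pi), radialPart f g t w) := by
  have key : ∀ a b, a + b ≤ n →
      IsSqrtPoly (2 * J) (fun w => (w ^ 2 - 1) ^ (J - 1) * (2 * (monomialIntegral a (b + 1) w
        - w * monomialIntegral (a + 1) b w))) := fun a b hab => by
    have h1 := (isSqrtPoly_monomialIntegral_of_le (a := a) (b := b + 1) (J := J)
      (by omega) (by omega)).mono (Nat.sub_le _ 1)
    have h2 := (isSqrtPoly_monomialIntegral_of_le (a := a + 1) (b := b) (J := J)
      (by omega) (by omega)).id_mul.mono (e := 2 * J) (by omega)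
    exact ((h1.sub h2).const_mul 2).congr fun w _ => by ring
  have key' : ∀ a b, a + b ≤ n →
      IsSqrtPoly (2 * J) (fun w => (w ^ 2 - 1) ^ (J - 1) * (2 * (monomialIntegral (a + 1) b w
        - w * monomialIntegral a (b + 1) w))) := fun a b hab => by
    have h1 := (isSqrtPoly_monomialIntegral_of_le (a := a + 1) (b := b) (J := J)
      (by omega) (by omega)).mono (Nat.sub_le _ 1)
    have h2 := (isSqrtPoly_monomialIntegral_of_le (a := a) (b := b + 1) (J := J)
      (by omega) (by omega)).id_mul.mono (e := 2 * J) (by omega)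
    exact ((h1.sub h2).const_mul 2).congr fun w _ => by ring
  have hdeg : ∀ {p : MvPolynomial (Fin 2) ℝ}, p.totalDegree ≤ n → ∀ d ∈ p.support,
      d 0 + d 1 ≤ n := fun {p} hp d hd => by
    have := (MvPolynomial.le_totalDegree hd).trans hp
    rwa [Finsupp.sum_fintype _ _ (fun _ => rfl), Fin.sum_univ_two] at this
  have hS := (IsSqrtPoly.sum f.support fun d hd =>
      (key (d 0) (d 1) (hdeg hf d hd)).const_mul (f.coeff d)).add
    (IsSqrtPoly.sum g.support fun d hd =>
      (key' (d 0) (d 1) (hdeg hg d hd)).const_mul (g.coeff d))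
  refine hS.congr fun w hw => ?_
  have hi := fun a b => (continuous_monomial hw a b).intervalIntegrable
    (μ := MeasureTheory.volume) 0 (2 * Real.pi)
  have h1 : ∀ t, radialPart f g t w
      = (∑ d ∈ f.support, f.coeff d * (2 *
          ((w - Real.sin (2 * t)) * ((polarPoint w t).1 ^ d 0 * (polarPoint w t).2 ^ (d 1 + 1))
          - w * ((w - Real.sin (2 * t))
            * ((polarPoint w t).1 ^ (d 0 + 1) * (polarPoint w t).2 ^ d 1)))))
        + ∑ d ∈ g.support, g.coeff d * (2 *
          ((w - Real.sin (2 * t)) * ((polarPoint w t).1 ^ (d 0 + 1) * (polarPoint w t).2 ^ d 1)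
          - w * ((w - Real.sin (2 * t))
            * ((polarPoint w t).1 ^ d 0 * (polarPoint w t).2 ^ (d 1 + 1))))) := fun t => by
    rw [radialPart, eval_eq_sum, eval_eq_sum, mul_add, Finset.mul_sum, Finset.mul_sum,
      Finset.mul_sum, Finset.mul_sum]
    congr 1 <;> exact Finset.sum_congr rfl fun d _ => by ring
  have hF := fun (p : MvPolynomial (Fin 2) ℝ) (d : Fin 2 →₀ ℕ) =>
    (((hi (d 0) (d 1 + 1)).sub ((hi (d 0 + 1) (d 1)).const_mul w)).const_mul 2).const_mul
      (p.coeff d)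
  have hG := fun (p : MvPolynomial (Fin 2) ℝ) (d : Fin 2 →₀ ℕ) =>
    (((hi (d 0 + 1) (d 1)).sub ((hi (d 0) (d 1 + 1)).const_mul w)).const_mul 2).const_mul
      (p.coeff d)
  simp only [h1]
  have hF' := IntervalIntegrable.sum f.support fun d _ => hF f d
  have hG' := IntervalIntegrable.sum g.support fun d _ => hG g d
  rw [Finset.sum_fn] at hF' hG'
  rw [integral_add hF' hG', integral_finsetSum fun d _ => hF f d,
    integral_finsetSum fun d _ => hG g d, mul_add, Finset.mul_sum, Finset.mul_sum]
  congr 1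
  · refine Finset.sum_congr rfl fun d _ => ?_
    rw [integral_const_mul, integral_const_mul, integral_sub (hi _ _) ((hi _ _).const_mul w),
      integral_const_mul]
    simp only [monomialIntegral]
    ring
  · refine Finset.sum_congr rfl fun d _ => ?_
    rw [integral_const_mul, integral_const_mul, integral_sub (hi _ _) ((hi _ _).const_mul w),
      integral_const_mul]
    simp only [monomialIntegral]
    ring

lemma radius_eq_polarRadius {h : ℝ} (hh : h ∈ Ioo (0 : ℝ) 1) (t : ℝ) :
    radius h t = polarRadius (1 / h) t := by
  have h1 := hh.1.ne'
  have h2 := (den_pos hh t).ne'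
  rw [radius, polarRadius]
  congr 1
  field_simp

/-- The Abelian integral is, up to the factor `h²`, the integral of `radialPart`: the integrand
is `- dH (f, g) = h² d(1/H) (f, g)`. -/
lemma abelianIntegral_eq (f g : MvPolynomial (Fin 2) ℝ) {h : ℝ} (hh : h ∈ Ioo (0 : ℝ) 1) :
    abelianIntegral f g h
      = h ^ 2 * ∫ t in (0 : ℝ)..(2 * Real.pi), radialPart f g t (1 / h) := by
  rw [abelianIntegral, ← integral_const_mul]
  refine integral_congr fun t _ => ?_
  have hd := hasDerivAt_curve hh t
  have h1 : deriv (fun s => (curve h s).1) t = (field 0 0 0 (curve h t)).1 := 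
    ((hasFDerivAt_fst (𝕜 := ℝ) (E := ℝ) (F := ℝ)).comp_hasDerivAt t hd).deriv
  have h2 : deriv (fun s => (curve h s).2) t = (field 0 0 0 (curve h t)).2 := 
    ((hasFDerivAt_snd (𝕜 := ℝ) (E := ℝ) (F := ℝ)).comp_hasDerivAt t hd).deriv
  have hw : 1 < 1 / h := (one_lt_one_div hh.1 hh.2)
  have h3 : curve h t = polarPoint (1 / h) t := by
    simp only [curve, polarPoint, radius_eq_polarRadius hh]
  simp only [h1, h2, h3, radialPart]
  have hr := polarRadius_sq hw t
  have hrp := polarRadius_pos hw t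
  have h5 := Real.sin_sq_add_cos_sq t
  have h6 := sub_sin_pos hw t
  simp only [field, polarPoint, mu, map_zero, mul_zero, add_zero]
  generalize MvPolynomial.eval _ f = F
  generalize MvPolynomial.eval _ g = G
  have hr' : polarRadius (1 / h) t ^ 2 * (1 / h - Real.sin (2 * t)) = 1 := by
    rw [hr]; exact inv_mul_cancel₀ h6.ne'
  rw [Real.sin_two_mul] at *
  set r := polarRadius (1 / h) t
  set s := Real.sin t
  set c := Real.cos t
  have hh0 := hh.1
  have h7 : 1 + 2 * (r * c) * (r * s) = r ^ 2 / h := by linear_combination -hr'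
  have h8 : (1 / h - 2 * s * c) = 1 / r ^ 2 := by
    rw [eq_div_iff (by positivity)]; linear_combination hr'
  have h9 : 1 / h = 1 / r ^ 2 + 2 * s * c := by linear_combination h8
  rw [h7, h8, h9]
  field_simp
  linear_combination (G * r ^ 2 * c + F * r ^ 2 * s) * h5

end CubicIsochronous

/-! ### Zeros of limits of holomorphic functions -/

namespace CubicIsochronous

open Filter Topology Metric

/-- Dividing out a zero is compatible with locally uniform limits of holomorphic functions. By
the maximum principle it suffices to control the quotients on circles that avoid the zero. -/
lemma tendstoLocallyUniformlyOn_dslope {U : Set ℂ} (hU : IsOpen U) {f : ℕ → ℂ → ℂ} {F : ℂ → ℂ}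
    (hf : ∀ k, DifferentiableOn ℂ (f k) U) (hlim : TendstoLocallyUniformlyOn f F atTop U)
    {x : ℕ → ℂ} {c : ℂ} (hc : c ∈ U) (hxU : ∀ k, x k ∈ U) (hx : Tendsto x atTop (𝓝 c))
    (h0 : ∀ k, f k (x k) = 0) :
    F c = 0 ∧ TendstoLocallyUniformlyOn (fun k => dslope (f k) (x k)) (dslope F c) atTop U := by
  have hF : DifferentiableOn ℂ F U := hlim.differentiableOn (Eventually.of_forall hf) hU
  have hFc : F c = 0 := by
    have h1 := hlim.tendsto_comp (hF.continuousOn c hc) hc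
      (tendsto_nhdsWithin_iff.2 ⟨hx, Eventually.of_forall hxU⟩)
    simp only [h0] at h1
    exact tendsto_nhds_unique h1 tendsto_const_nhds |>.symm ▸ rfl
  refine ⟨hFc, ?_⟩
  rw [Metric.tendstoLocallyUniformlyOn_iff]
  intro ε hε z₀ hz₀
  obtain ⟨R, hR, hRU, hRc⟩ : ∃ R > 0, closedBall z₀ R ⊆ U ∧ dist c z₀ ≠ R := by
    obtain ⟨R, hR, hRU⟩ := nhds_basis_closedBall.mem_iff.1 (hU.mem_nhds hz₀)
    by_cases h : dist c z₀ = R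
    · exact ⟨R / 2, by positivity, (closedBall_subset_closedBall (by linarith)).trans hRU,
        by rw [h]; linarith⟩
    · exact ⟨R, hR, hRU, h⟩
  set δ := |dist c z₀ - R| with hδ
  have hδ0 : 0 < δ := abs_pos.2 (sub_ne_zero.2 hRc)
  have hdist : ∀ z ∈ sphere z₀ R, δ ≤ ‖z - c‖ := fun z hz => by
    rw [hδ, ← mem_sphere.1 hz, ← dist_eq_norm, dist_comm z c]
    exact abs_dist_sub_le c z z₀
  have hS : sphere z₀ R ⊆ U := sphere_subset_closedBall.trans hRU
  obtain ⟨M, hM⟩ := (isCompact_sphere z₀ R).exists_bound_of_continuousOn (hF.continuousOn.mono hS)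
  have hunif := (tendstoLocallyUniformlyOn_iff_forall_isCompact hU).1 hlim _ hS
    (isCompact_sphere z₀ R)
  set K := 2 / δ + 2 * |M| / δ ^ 2 with hK
  have hK0 : 0 ≤ K := by positivity
  set e := ε / (2 * (K + 1)) with he
  have he0 : 0 < e := by positivity
  have hx1 : ∀ᶠ k in atTop, dist (x k) c < min e (δ / 2) :=
    (Metric.tendsto_nhds.1 hx) _ (by positivity)
  refine ⟨closedBall z₀ R, mem_nhdsWithin_of_mem_nhds (closedBall_mem_nhds z₀ hR), ?_⟩
  filter_upwards [(Metric.tendstoUniformlyOn_iff.1 hunif) e he0, hx1] with k hk hxk z hz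
  have hd : DifferentiableOn ℂ (fun z => dslope F c z - dslope (f k) (x k) z) U :=
    ((Complex.differentiableOn_dslope (hU.mem_nhds hc)).2 hF).sub
      ((Complex.differentiableOn_dslope (hU.mem_nhds (hxU k))).2 (hf k))
  have hfr : ∀ z ∈ frontier (ball z₀ R),
      ‖dslope F c z - dslope (f k) (x k) z‖ ≤ e * K := by
    intro z hz
    rw [frontier_ball z₀ hR.ne'] at hz
    have h1 := hdist z hz
    have h2 : ‖x k - c‖ < min e (δ / 2) := by rw [← dist_eq_norm]; exact hxk
    have h2e := h2.trans_le (min_le_left _ _)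
    have h2δ := h2.trans_le (min_le_right _ _)
    have h3 : δ / 2 ≤ ‖z - x k‖ := by
      have := norm_sub_norm_le (z - c) (x k - c)
      rw [sub_sub_sub_cancel_right] at this
      linarith
    have hzc : z - c ≠ 0 := norm_pos_iff.1 (by linarith)
    have hzx : z - x k ≠ 0 := norm_pos_iff.1 (by linarith)
    rw [dslope_of_ne _ (sub_ne_zero.1 hzc), dslope_of_ne _ (sub_ne_zero.1 hzx), slope_def_field,
      slope_def_field, hFc, h0, sub_zero, sub_zero]
    have h4 : F z / (z - c) - f k z / (z - x k)
        = (F z - f k z) / (z - x k) - F z * (x k - c) / ((z - x k) * (z - c)) := by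
      field_simp
      ring
    rw [h4]
    have h5 : ‖(F z - f k z) / (z - x k)‖ ≤ e / (δ / 2) := by
      rw [norm_div]
      have := (hk z hz).le
      rw [dist_eq_norm] at this
      gcongr
    have h6 : ‖F z * (x k - c) / ((z - x k) * (z - c))‖ ≤ |M| * e / (δ / 2 * δ) := by
      rw [norm_div, norm_mul, norm_mul]
      have := (hM z hz).trans (le_abs_self M)
      gcongr
    refine (norm_sub_le _ _).trans ((add_le_add h5 h6).trans (le_of_eq ?_))
    rw [hK]
    field_simp
  have hle := Complex.norm_le_of_forall_mem_frontier_norm_le isBounded_ball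
    (DifferentiableOn.diffContOnCl (hd.mono (by rwa [closure_ball z₀ hR.ne']))) hfr
    (by rwa [closure_ball z₀ hR.ne'])
  rw [dist_eq_norm]
  refine hle.trans_lt ?_
  rw [he, div_mul_eq_mul_div, div_lt_iff₀ (by positivity)]
  nlinarith

/-- If holomorphic functions with `m` distinct zeros converge locally uniformly, and the zeros
converge in the domain, then the limit is divisible by the product of the limiting linear
factors. Coinciding limits thus count as multiple zeros. -/
lemma exists_eq_prod_mul_of_tendsto_zeros {U : Set ℂ} (hU : IsOpen U) {m : ℕ}
    {f : ℕ → ℂ → ℂ} {F : ℂ → ℂ}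
    (hf : ∀ k, DifferentiableOn ℂ (f k) U) (hlim : TendstoLocallyUniformlyOn f F atTop U)
    {x : ℕ → Fin m → ℂ} {c : Fin m → ℂ} (hc : ∀ i, c i ∈ U) (hxU : ∀ k i, x k i ∈ U)
    (hx : ∀ i, Tendsto (fun k => x k i) atTop (𝓝 (c i))) (hinj : ∀ k, Function.Injective (x k))
    (h0 : ∀ k i, f k (x k i) = 0) :
    ∃ G : ℂ → ℂ, ContinuousOn G U ∧ ∀ z ∈ U, F z = (∏ i, (z - c i)) * G z := by
  induction m generalizing f F with
  | zero =>
    exact ⟨F, (hlim.differentiableOn (Eventually.of_forall hf) hU).continuousOn, by simp⟩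
  | succ m ih =>
    obtain ⟨hF0, hlim'⟩ := tendstoLocallyUniformlyOn_dslope hU hf hlim (hc 0)
      (fun k => hxU k 0) (hx 0) (fun k => h0 k 0)
    obtain ⟨G, hG, hFG⟩ := ih
      (fun k => (Complex.differentiableOn_dslope (hU.mem_nhds (hxU k 0))).2 (hf k)) hlim'
      (x := fun k i => x k i.succ) (c := fun i => c i.succ) (fun i => hc _)
      (fun k i => hxU k _) (fun i => hx _)
      (fun k => (hinj k).comp (Fin.succ_injective m)) (fun k i => by
        have hne : x k i.succ ≠ x k 0 := fun h => Fin.succ_ne_zero i (hinj k h)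
        rw [dslope_of_ne _ hne, slope_def_field, h0, h0]
        simp)
    refine ⟨G, hG, fun z hz => ?_⟩
    have h1 := sub_smul_dslope F (c 0) z
    rw [hF0, sub_zero, smul_eq_mul, hFG z hz] at h1
    rw [← h1, Fin.prod_univ_succ]
    ring

/-- Integrals of a family of holomorphic functions are holomorphic. -/
lemma differentiableOn_intervalIntegral {U : Set ℂ} (hU : IsOpen U) {h : ℂ → ℝ → ℂ}
    (hcont : ContinuousOn (Function.uncurry h) (U ×ˢ univ))
    (hd : ∀ t, DifferentiableOn ℂ (fun w => h w t) U) (a b : ℝ) :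
    DifferentiableOn ℂ (fun w => ∫ t in a..b, h w t) U := by
  intro w₀ hw₀
  refine DifferentiableAt.differentiableWithinAt ?_
  have hct : ∀ w ∈ U, Continuous (h w) := fun w hw =>
    hcont.comp_continuous (by fun_prop : Continuous fun t : ℝ => (w, t)) fun t => ⟨hw, trivial⟩
  obtain ⟨R, hR, hRU⟩ := nhds_basis_closedBall.mem_iff.1 (hU.mem_nhds hw₀)
  have hcomp : IsCompact (closedBall w₀ R ×ˢ uIcc a b) :=
    (isCompact_closedBall w₀ R).prod isCompact_uIcc
  obtain ⟨M, hM⟩ := hcomp.exists_bound_of_continuousOn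
    (hcont.mono (prod_mono hRU (subset_univ _)))
  have hU' : ball w₀ (R / 2) ⊆ U := (ball_subset_ball (by linarith)).trans
    (ball_subset_closedBall.trans hRU)
  refine ((intervalIntegral.hasDerivAt_integral_of_dominated_loc_of_deriv_le
    (μ := MeasureTheory.volume) (F := h) (F' := fun w t => deriv (fun w => h w t) w)
    (bound := fun _ => M / (R / 2)) (ball_mem_nhds w₀ (by positivity : 0 < R / 2))
    ?_ ?_ ?_ ?_ ?_ ?_).2).differentiableAt
  · filter_upwards [hU.mem_nhds hw₀] with w hw
    exact (hct w hw).aestronglyMeasurable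
  · exact (hct w₀ hw₀).intervalIntegrable _ _
  · -- the derivative is a limit of difference quotients
    have hseq : Tendsto (fun n : ℕ => w₀ + ((R / (n + 1 : ℝ) : ℝ) : ℂ)) atTop (𝓝[≠] w₀) := by
      refine tendsto_nhdsWithin_iff.2 ⟨?_, Eventually.of_forall fun n => ?_⟩
      · have h1 : Tendsto (fun n : ℕ => ((R / (n + 1 : ℝ) : ℝ))) atTop (𝓝 0) := by
          have := (tendsto_one_div_add_atTop_nhds_zero_nat (𝕜 := ℝ)).const_mul R
          simpa [div_eq_mul_inv] using this
        have h2 := (Complex.continuous_ofReal.tendsto 0).comp h1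
        simpa using h2.const_add w₀
      · have : (0 : ℝ) < R / (n + 1 : ℝ) := by positivity
        rw [mem_compl_iff, mem_singleton_iff, add_eq_left]
        exact_mod_cast this.ne'
    refine aestronglyMeasurable_of_tendsto_ae atTop
      (f := fun (n : ℕ) t => slope (fun w => h w t) w₀ (w₀ + ((R / (n + 1 : ℝ) : ℝ) : ℂ)))
      (fun n => ?_)
      (Eventually.of_forall fun t => ?_)
    · simp only [slope_def_field]
      have hmem : w₀ + ((R / (n + 1 : ℝ) : ℝ) : ℂ) ∈ U := by
        apply hRU
        rw [mem_closedBall, dist_eq_norm, add_sub_cancel_left, Complex.norm_real, Real.norm_eq_abs,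
          abs_of_pos (by positivity)]
        exact div_le_self hR.le (by linarith [(Nat.cast_nonneg n : (0 : ℝ) ≤ n)])
      exact (((hct _ hmem).sub (hct _ hw₀)).div_const _).aestronglyMeasurable
    · exact (hasDerivAt_iff_tendsto_slope.1
        ((hd t).differentiableAt (hU.mem_nhds hw₀)).hasDerivAt).comp hseq
  · refine Eventually.of_forall fun t ht w hw => ?_
    have hsub : closedBall w (R / 2) ⊆ closedBall w₀ R := by
      refine closedBall_subset_closedBall' ?_
      have := mem_ball.1 hw
      linarith
    refine Complex.norm_deriv_le_of_forall_mem_sphere_norm_le (by positivity)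
      (DifferentiableOn.diffContOnCl ?_) fun z hz => ?_
    · rw [closure_ball _ (by positivity)]
      exact (hd t).mono (hsub.trans hRU)
    · exact hM (z, t) ⟨hsub (sphere_subset_closedBall hz), uIoc_subset_uIcc ht⟩
  · exact intervalIntegrable_const
  · exact Eventually.of_forall fun t _ w hw =>
      ((hd t).differentiableAt (hU.mem_nhds (hU' hw))).hasDerivAt

end CubicIsochronous

/-! ### Holomorphic dependence on the initial value -/

namespace CubicIsochronous

open Filter Topology Metric intervalIntegral

/-- The Picard iterates, started at the constant solution, of `∂φ/∂θ = G(θ, φ)`, `φ = w` at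
`θ = 0`, on `[0, T]`. They are extended to all `θ` by their values at the ends. -/
noncomputable def picardIterate (G : ℝ → ℂ → ℂ) (T : ℝ) : ℕ → ℂ → ℝ → ℂ
  | 0, w, _ => w
  | k + 1, w, t => w + ∫ s in (0 : ℝ)..(max 0 (min t T)), G s (picardIterate G T k w s)

section Picard

variable {G : ℝ → ℂ → ℂ} {T m ℓ : ℝ} {U U' : Set ℂ}

lemma norm_picardIterate_sub_le (hT : 0 ≤ T)
    (hUU' : ∀ w ∈ U, ∀ z, ‖z - w‖ ≤ m * T → z ∈ U') (hm0 : 0 ≤ m)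
    (hm : ∀ t, ∀ z ∈ U', ‖G t z‖ ≤ m) (k : ℕ) {w : ℂ} (hw : w ∈ U) (t : ℝ) :
    ‖picardIterate G T k w t - w‖ ≤ m * T := by
  induction k generalizing t with
  | zero => simpa [picardIterate] using mul_nonneg hm0 hT
  | succ k ih =>
    rw [picardIterate, add_sub_cancel_left]
    refine (norm_integral_le_of_norm_le_const fun s _ => hm s _ (hUU' w hw _ (ih s))).trans ?_
    rw [sub_zero, abs_of_nonneg (le_max_left _ _)]
    gcongr
    exact max_le hT (min_le_right _ _)

lemma continuousOn_picardIterate (hT : 0 ≤ T)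
    (hUU' : ∀ w ∈ U, ∀ z, ‖z - w‖ ≤ m * T → z ∈ U') (hm0 : 0 ≤ m)
    (hm : ∀ t, ∀ z ∈ U', ‖G t z‖ ≤ m)
    (hGc : ContinuousOn (Function.uncurry G) (univ ×ˢ U')) (k : ℕ) :
    ContinuousOn (Function.uncurry (picardIterate G T k)) (U ×ˢ univ) := by
  induction k with
  | zero => exact continuousOn_fst
  | succ k ih =>
    have h1 : ContinuousOn (fun p : ℂ × ℝ => G p.2 (picardIterate G T k p.1 p.2))
        (U ×ˢ univ) := by
      refine hGc.comp (continuousOn_snd.prodMk ih) fun p hp => ⟨trivial, ?_⟩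
      exact hUU' p.1 hp.1 _ (norm_picardIterate_sub_le hT hUU' hm0 hm k hp.1 p.2)
    have h2 : Continuous (Function.uncurry fun (w : U) (s : ℝ) =>
        G s (picardIterate G T k w s)) :=
      h1.comp_continuous (f := fun p : U × ℝ => ((p.1 : ℂ), p.2)) (by fun_prop)
        fun p => ⟨p.1.2, trivial⟩
    have h3 := continuous_parametric_primitive_of_continuous (μ := MeasureTheory.volume)
      (a₀ := 0) h2
    rw [continuousOn_iff_continuous_domRestrict]
    have h4 : Continuous fun p : ↥(U ×ˢ (univ : Set ℝ)) =>
        ((⟨p.1.1, p.2.1⟩ : U), max 0 (min p.1.2 T)) := by fun_prop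
    exact (continuous_fst.comp continuous_subtype_val).add (h3.comp h4)

/-- If `G` is so small that the Picard map on `[0, T]` is a contraction, then the increment over
`[0, T]` of the solution of `∂φ/∂θ = G(θ, φ)` is a holomorphic function `D` of the initial value,
which is close to the integral of `G` along the constant solution. -/
lemma exists_holomorphic_increment (hT : 0 ≤ T) (hU : IsOpen U)
    (hUU' : ∀ w ∈ U, ∀ z, ‖z - w‖ ≤ m * T → z ∈ U') (hm0 : 0 ≤ m)
    (hm : ∀ t, ∀ z ∈ U', ‖G t z‖ ≤ m)
    (hGc : ContinuousOn (Function.uncurry G) (univ ×ˢ U'))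
    (hGd : ∀ t, DifferentiableOn ℂ (G t) U') (hℓ0 : 0 ≤ ℓ)
    (hℓ : ∀ t, ∀ z ∈ U', ∀ z' ∈ U', ‖G t z - G t z'‖ ≤ ℓ * ‖z - z'‖) (hℓT : ℓ * T ≤ 1 / 2) :
    ∃ D : ℂ → ℂ, DifferentiableOn ℂ D U ∧
      (∀ w ∈ U, ‖D w - ∫ s in (0 : ℝ)..T, G s w‖ ≤ ℓ * T * (m * T)) ∧
      ∀ w ∈ U, ∀ W : ℝ → ℂ, Continuous W → (∀ t, W t ∈ U') →
        (∀ t ∈ Icc 0 T, W t = w + ∫ s in (0 : ℝ)..t, G s (W s)) → W T = w + D w := by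
  set φ := picardIterate G T with hφ
  have hC0 : 0 ≤ m * T := mul_nonneg hm0 hT
  have hbd : ∀ k, ∀ w ∈ U, ∀ t, ‖φ k w t - w‖ ≤ m * T := fun k w hw t =>
    norm_picardIterate_sub_le hT hUU' hm0 hm k hw t
  have hmem : ∀ k, ∀ w ∈ U, ∀ t, φ k w t ∈ U' := fun k w hw t => hUU' w hw _ (hbd k w hw t)
  have hself : ∀ w ∈ U, w ∈ U' := fun w hw => hUU' w hw w (by simpa using hC0)
  have hφc : ∀ k, ContinuousOn (Function.uncurry (φ k)) (U ×ˢ univ) :=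
    continuousOn_picardIterate hT hUU' hm0 hm hGc
  have hGφ : ∀ k, ContinuousOn (fun p : ℂ × ℝ => G p.2 (φ k p.1 p.2)) (U ×ˢ univ) := fun k =>
    hGc.comp (continuousOn_snd.prodMk (hφc k)) fun p hp => ⟨trivial, hmem k p.1 hp.1 p.2⟩
  have hGφ' : ∀ k, ∀ w ∈ U, Continuous fun s => G s (φ k w s) := fun k w hw =>
    (hGφ k).comp_continuous (by fun_prop : Continuous fun t : ℝ => (w, t)) fun t => ⟨hw, trivial⟩
  have hint : ∀ {u v : ℝ → ℂ} {C : ℝ}, (Continuous fun s => G s (u s)) →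
      (Continuous fun s => G s (v s)) → (∀ s, u s ∈ U') → (∀ s, v s ∈ U') →
      ∀ t ∈ Icc 0 T, (∀ s ∈ Icc 0 T, ‖u s - v s‖ ≤ C) →
      ‖(∫ s in (0 : ℝ)..t, G s (u s)) - ∫ s in (0 : ℝ)..t, G s (v s)‖ ≤ ℓ * T * C := by
    intro u v C hu hv hu' hv' t ht huv
    have hC : 0 ≤ C := (norm_nonneg _).trans (huv t ht)
    rw [← integral_sub (hu.intervalIntegrable _ _) (hv.intervalIntegrable _ _)]
    refine (norm_integral_le_of_norm_le_const (C := ℓ * C) fun s hs => ?_).trans ?_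
    · rw [uIoc_of_le ht.1] at hs
      refine (hℓ s _ (hu' s) _ (hv' s)).trans ?_
      gcongr
      exact huv s ⟨hs.1.le, hs.2.trans ht.2⟩
    · rw [sub_zero, abs_of_nonneg ht.1]
      nlinarith [mul_le_mul_of_nonneg_left ht.2 (mul_nonneg hℓ0 hC)]
  have hsucc : ∀ k w, ∀ t ∈ Icc 0 T, φ (k + 1) w t = w + ∫ s in (0 : ℝ)..t, G s (φ k w s) := by
    intro k w t ht
    rw [hφ, picardIterate, min_eq_left ht.2, max_eq_right ht.1]
  have hTT : T ∈ Icc 0 T := ⟨hT, le_rfl⟩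
  have hhalf : ∀ k : ℕ, ℓ * T * (m * T * (1 / 2) ^ k) ≤ m * T * (1 / 2) ^ (k + 1) := fun k => by
    have : 0 ≤ m * T * (1 / 2 : ℝ) ^ k := by positivity
    rw [pow_succ]
    nlinarith
  have hstep : ∀ k, ∀ w ∈ U, ∀ t ∈ Icc 0 T,
      ‖φ (k + 1) w t - φ k w t‖ ≤ m * T * (1 / 2) ^ k := by
    intro k w hw
    induction k with
    | zero => intro t _; simpa [φ, picardIterate] using hbd 1 w hw t
    | succ k ih =>
      intro t ht
      rw [hsucc (k + 1) w t ht, hsucc k w t ht, add_sub_add_left_eq_sub]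
      exact (hint (hGφ' _ w hw) (hGφ' _ w hw) (hmem _ w hw) (hmem _ w hw) t ht ih).trans (hhalf k)
  have hdist : ∀ w ∈ U, ∀ k, dist (φ k w T) (φ (k + 1) w T) ≤ m * T * (1 / 2) ^ k :=
    fun w hw k => by rw [dist_comm, dist_eq_norm]; exact hstep k w hw T hTT
  have hlim : ∀ w ∈ U, ∃ l, Tendsto (fun k => φ k w T) atTop (𝓝 l) := fun w hw =>
    cauchySeq_tendsto_of_complete
      (cauchySeq_of_le_geometric (1 / 2) _ (by norm_num) (hdist w hw))
  choose! Φ hΦ using hlim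
  have hgeom : Tendsto (fun k : ℕ => m * T * (1 / 2 : ℝ) ^ k) atTop (𝓝 0) := by
    simpa using (tendsto_pow_atTop_nhds_zero_of_lt_one (r := (1 / 2 : ℝ)) (by norm_num)
      (by norm_num)).const_mul (m * T)
  have hunif : TendstoUniformlyOn (fun k w => φ k w T) Φ atTop U := by
    rw [Metric.tendstoUniformlyOn_iff]
    intro ε hε
    have h2 : Tendsto (fun k : ℕ => m * T * (1 / 2 : ℝ) ^ k / (1 - 1 / 2)) atTop (𝓝 0) := by
      simpa using hgeom.div_const (1 - 1 / 2)
    filter_upwards [h2.eventually (gt_mem_nhds hε)] with k hk w hw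
    rw [dist_comm]
    exact (dist_le_of_le_geometric_of_tendsto (1 / 2) _ (by norm_num) (hdist w hw) (hΦ w hw)
      k).trans_lt hk
  have hφd : ∀ k t, DifferentiableOn ℂ (fun w => φ k w t) U := by
    intro k
    induction k with
    | zero => intro t; exact differentiableOn_id
    | succ k ih =>
      intro t
      refine differentiableOn_id.add (differentiableOn_intervalIntegral hU
        (h := fun w s => G s (φ k w s)) (hGφ k) (fun s => ?_) _ _)
      exact (hGd s).comp (ih s) fun w hw => hmem k w hw s
  refine ⟨fun w => Φ w - w, ?_, fun w hw => ?_, fun w hw W hWc hWU hW => ?_⟩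
  · exact (hunif.tendstoLocallyUniformlyOn.differentiableOn
      (Eventually.of_forall fun k => hφd k T) hU).sub differentiableOn_id
  · have h1 : Tendsto (fun k => ‖φ (k + 1) w T - w - ∫ s in (0 : ℝ)..T, G s w‖) atTop
        (𝓝 ‖Φ w - w - ∫ s in (0 : ℝ)..T, G s w‖) :=
      ((((hΦ w hw).comp (tendsto_add_atTop_nat 1)).sub_const _).sub_const _).norm
    refine le_of_tendsto h1 (Eventually.of_forall fun k => ?_)
    rw [hsucc k w T hTT, add_sub_cancel_left]
    exact hint (v := fun _ => w) (hGφ' k w hw) (hGφ' 0 w hw) (hmem k w hw)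
      (fun _ => hself w hw) T hTT fun s _ => hbd k w hw s
  · have hGW : Continuous fun s => G s (W s) :=
      hGc.comp_continuous (continuous_id.prodMk hWc) fun t => ⟨trivial, hWU t⟩
    have h1 : ∀ k, ∀ t ∈ Icc 0 T, ‖W t - φ k w t‖ ≤ m * T * (1 / 2) ^ k := by
      intro k
      induction k with
      | zero =>
        intro t ht
        rw [hW t ht, pow_zero, mul_one]
        change ‖w + _ - w‖ ≤ _
        rw [add_sub_cancel_left]
        refine (norm_integral_le_of_norm_le_const fun s _ => hm s _ (hWU s)).trans ?_
        rw [sub_zero, abs_of_nonneg ht.1]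
        exact mul_le_mul_of_nonneg_left ht.2 hm0
      | succ k ih =>
        intro t ht
        rw [hW t ht, hsucc k w t ht, add_sub_add_left_eq_sub]
        exact (hint hGW (hGφ' k w hw) hWU (hmem k w hw) t ht ih).trans (hhalf k)
    have h2 : Tendsto (fun k => W T - φ k w T) atTop (𝓝 0) :=
      squeeze_zero_norm (fun k => h1 k T hTT) hgeom
    have h3 : Tendsto (fun k => φ k w T) atTop (𝓝 (W T)) := by
      simpa using (tendsto_const_nhds (x := W T)).sub h2
    rw [tendsto_nhds_unique h3 (hΦ w hw)]
    ring

end Picard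

end CubicIsochronous

/-! ### First order averaging -/

namespace CubicIsochronous

open Filter Topology Metric intervalIntegral

lemma one_lt_re_of_mem_cthickening {α β r : ℝ} (hr : 0 ≤ r) (h : 1 < α - r) {z : ℂ}
    (hz : z ∈ cthickening r ((fun x : ℝ => (x : ℂ)) '' Icc α β)) : 1 < z.re := by
  have hcomp : IsCompact ((fun x : ℝ => (x : ℂ)) '' Icc α β) :=
    isCompact_Icc.image Complex.continuous_ofReal
  rw [hcomp.cthickening_eq_biUnion_closedBall hr] at hz
  obtain ⟨_, ⟨x, hx, rfl⟩, hzx⟩ := mem_iUnion₂.1 hz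
  have h1 := Complex.abs_re_le_norm (z - (x : ℂ))
  rw [← dist_eq_norm, Complex.sub_re, Complex.ofReal_re] at h1
  replace h1 := h1.trans (mem_closedBall.1 hzx)
  linarith [(abs_le.1 h1).1, hx.1]

/-- First order averaging for `dw/dθ = ε B(θ, w) / (1 + ε A(θ, w))` with `A`, `B` holomorphic
in `w` and `2π`-periodic in `θ`: the increment of the solutions over a period, divided by `ε`, is
holomorphic in the initial value, on a complex neighbourhood of `[α, β]` that does not depend on
`ε`, and converges there uniformly to the integral of `B`. -/
lemma exists_averaging {A B : ℝ → ℂ → ℂ}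
    (hA : ContinuousOn (Function.uncurry A) (univ ×ˢ {z : ℂ | 1 < z.re}))
    (hB : ContinuousOn (Function.uncurry B) (univ ×ˢ {z : ℂ | 1 < z.re}))
    (hAd : ∀ t, DifferentiableOn ℂ (A t) {z : ℂ | 1 < z.re})
    (hBd : ∀ t, DifferentiableOn ℂ (B t) {z : ℂ | 1 < z.re})
    (hAp : Function.Periodic A (2 * Real.pi)) (hBp : Function.Periodic B (2 * Real.pi))
    {α β : ℝ} (hα : 1 < α) :
    ∃ (U : Set ℂ) (C ε₁ : ℝ) (D : ℝ → ℂ → ℂ), IsOpen U ∧ (∀ x ∈ Icc α β, (x : ℂ) ∈ U) ∧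
      U ⊆ {z : ℂ | 1 < z.re} ∧ 0 < ε₁ ∧ ∀ ε : ℝ, 0 < |ε| → |ε| < ε₁ →
        (∀ t, ∀ x ∈ Icc α β, ‖(ε : ℂ) * A t (x : ℂ)‖ ≤ 1 / 2) ∧
        (∃ L : ℝ, ∀ t, ∀ x ∈ Icc α β, ∀ y ∈ Icc α β,
          ‖(ε : ℂ) * B t (x : ℂ) / (1 + (ε : ℂ) * A t (x : ℂ))
            - (ε : ℂ) * B t (y : ℂ) / (1 + (ε : ℂ) * A t (y : ℂ))‖ ≤ L * |x - y|) ∧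
        DifferentiableOn ℂ (D ε) U ∧
        (∀ w ∈ U, ‖D ε w - ∫ t in (0 : ℝ)..(2 * Real.pi), B t w‖ ≤ C * |ε|) ∧
        ∀ W : ℝ → ℝ, (∀ t, W t ∈ Icc α β ∧ HasDerivAt (fun t => (W t : ℂ))
          ((ε : ℂ) * B t (W t) / (1 + (ε : ℂ) * A t (W t))) t) →
          W (2 * Real.pi) = W 0 → D ε (W 0) = 0 := by
  set K : Set ℂ := (fun x : ℝ => (x : ℂ)) '' Icc α β with hK
  have hKc : IsCompact K := isCompact_Icc.image Complex.continuous_ofReal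
  have hKconv : Convex ℝ K := (convex_Icc α β).is_linear_image
    (f := fun x : ℝ => (x : ℂ)) ⟨by simp, by simp⟩
  set ρ := (α - 1) / 4 with hρ
  have hρ0 : 0 < ρ := by rw [hρ]; linarith
  set V := cthickening (3 * ρ) K with hV
  have hVre : V ⊆ {z : ℂ | 1 < z.re} := fun z hz =>
    one_lt_re_of_mem_cthickening (by positivity) (by linarith) hz
  have hVc : IsCompact V := hKc.cthickening
  -- bounds for `A` and `B` on `V`
  have hbound : ∀ E : ℝ → ℂ → ℂ, ContinuousOn (Function.uncurry E) (univ ×ˢ {z : ℂ | 1 < z.re}) →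
      Function.Periodic E (2 * Real.pi) → ∃ M, ∀ t, ∀ z ∈ V, ‖E t z‖ ≤ M := by
    intro E hE hEp
    obtain ⟨M, hM⟩ := (isCompact_Icc (a := (0 : ℝ)) (b := 2 * Real.pi)).prod hVc
      |>.exists_bound_of_continuousOn (hE.mono (prod_mono (subset_univ _) hVre))
    refine ⟨M, fun t z hz => ?_⟩
    obtain ⟨s, hs, hst⟩ := hEp.exists_mem_Ico₀ Real.two_pi_pos t
    rw [hst]
    exact hM (s, z) ⟨⟨hs.1, hs.2.le⟩, hz⟩
  obtain ⟨MA, hMA⟩ := hbound A hA hAp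
  obtain ⟨MB, hMB⟩ := hbound B hB hBp
  set M := |MA| + |MB| + 1 with hM
  have hM0 : 0 < M := by positivity
  replace hMA : ∀ t, ∀ z ∈ V, ‖A t z‖ ≤ M := fun t z hz => (hMA t z hz).trans
    (by linarith [le_abs_self MA, abs_nonneg MB])
  replace hMB : ∀ t, ∀ z ∈ V, ‖B t z‖ ≤ M := fun t z hz => (hMB t z hz).trans
    (by linarith [le_abs_self MB, abs_nonneg MA])
  set U := thickening ρ K with hU
  set U' := thickening (2 * ρ) K with hU'
  have hUU' : ∀ w ∈ U, ∀ z, ‖z - w‖ ≤ ρ → z ∈ U' := by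
    intro w hw z hz
    obtain ⟨x, hx, hwx⟩ := mem_thickening_iff.1 hw
    refine mem_thickening_iff.2 ⟨x, hx, ?_⟩
    rw [← dist_eq_norm] at hz
    linarith [dist_triangle z w x]
  have hU'V : U' ⊆ V := (thickening_subset_cthickening _ _).trans
    (cthickening_mono (by linarith) K)
  have hUV : U ⊆ V := (thickening_subset_cthickening _ _).trans
    (cthickening_mono (by linarith) K)
  have hball : ∀ z ∈ U', closedBall z ρ ⊆ V := by
    intro z hz y hy
    obtain ⟨x, hx, hzx⟩ := mem_thickening_iff.1 hz
    refine mem_cthickening_of_dist_le y x _ _ hx ?_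
    linarith [dist_triangle y z x, mem_closedBall.1 hy]
  have hKU : ∀ x ∈ Icc α β, (x : ℂ) ∈ U := fun x hx =>
    self_subset_thickening hρ0 K ⟨x, hx, rfl⟩
  have hKU' : ∀ x ∈ Icc α β, (x : ℂ) ∈ U' := fun x hx =>
    self_subset_thickening (by positivity) K ⟨x, hx, rfl⟩
  have hπ := Real.pi_pos
  set ε₁ := min (1 / (2 * M)) (ρ / (8 * Real.pi * M)) with hε₁
  set C := 2 * M / ρ * (2 * Real.pi) * (2 * M * (2 * Real.pi)) + 2 * M ^ 2 * (2 * Real.pi) with hC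
  have main : ∀ ε : ℝ, 0 < |ε| → |ε| < ε₁ → ∃ D : ℂ → ℂ,
        (∀ t, ∀ x ∈ Icc α β, ‖(ε : ℂ) * A t (x : ℂ)‖ ≤ 1 / 2) ∧
        (∃ L : ℝ, ∀ t, ∀ x ∈ Icc α β, ∀ y ∈ Icc α β,
          ‖(ε : ℂ) * B t (x : ℂ) / (1 + (ε : ℂ) * A t (x : ℂ))
            - (ε : ℂ) * B t (y : ℂ) / (1 + (ε : ℂ) * A t (y : ℂ))‖ ≤ L * |x - y|) ∧
        DifferentiableOn ℂ D U ∧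
        (∀ w ∈ U, ‖D w - ∫ t in (0 : ℝ)..(2 * Real.pi), B t w‖ ≤ C * |ε|) ∧
        ∀ W : ℝ → ℝ, (∀ t, W t ∈ Icc α β ∧ HasDerivAt (fun t => (W t : ℂ))
          ((ε : ℂ) * B t (W t) / (1 + (ε : ℂ) * A t (W t))) t) →
          W (2 * Real.pi) = W 0 → D (W 0) = 0 := by
    intro ε hε0 hε
    have hεc : (ε : ℂ) ≠ 0 := by
      intro h
      rw [Complex.ofReal_eq_zero.1 h, abs_zero] at hε0
      exact lt_irrefl _ hε0
    have hnε : ‖(ε : ℂ)‖ = |ε| := by rw [Complex.norm_real, Real.norm_eq_abs]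
    have hεM : |ε| * M ≤ 1 / 2 := by
      have := (hε.trans_le (min_le_left _ _)).le
      rw [le_div_iff₀ (by positivity)] at this
      linarith
    have hερ : 8 * Real.pi * (|ε| * M) ≤ ρ := by
      have := (hε.trans_le (min_le_right _ _)).le
      rw [le_div_iff₀ (by positivity)] at this
      linarith
    have hεA : ∀ t, ∀ z ∈ V, ‖(ε : ℂ) * A t z‖ ≤ 1 / 2 := fun t z hz => by
      rw [norm_mul, hnε]
      exact (mul_le_mul_of_nonneg_left (hMA t z hz) (abs_nonneg ε)).trans hεM
    have hden : ∀ t, ∀ z ∈ V, 1 / 2 ≤ ‖1 + (ε : ℂ) * A t z‖ := fun t z hz => by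
      have h1 := norm_sub_norm_le (1 : ℂ) (-((ε : ℂ) * A t z))
      rw [sub_neg_eq_add, norm_neg, norm_one] at h1
      linarith [hεA t z hz]
    have hden0 : ∀ t, ∀ z ∈ V, 1 + (ε : ℂ) * A t z ≠ 0 := fun t z hz =>
      norm_pos_iff.1 (by linarith [hden t z hz])
    set G : ℝ → ℂ → ℂ := fun t z => (ε : ℂ) * B t z / (1 + (ε : ℂ) * A t z) with hG
    set m := 2 * (|ε| * M) with hm
    have hGm : ∀ t, ∀ z ∈ V, ‖G t z‖ ≤ m := fun t z hz => by
      rw [hG, norm_div, norm_mul, hnε, div_le_iff₀ (by linarith [hden t z hz])]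
      have h1 := mul_le_mul_of_nonneg_left (hMB t z hz) (abs_nonneg ε)
      have h2 : 0 ≤ |ε| * M := by positivity
      nlinarith [hden t z hz]
    have hGd : ∀ t, DifferentiableOn ℂ (G t) V := fun t =>
      (((hBd t).mono hVre).const_mul _).div
        (((hAd t).mono hVre).const_mul _ |>.const_add _) (hden0 t)
    have hGc : ContinuousOn (Function.uncurry G) (univ ×ˢ V) := by
      have hs : (univ : Set ℝ) ×ˢ V ⊆ univ ×ˢ {z : ℂ | 1 < z.re} :=
        prod_mono (subset_univ _) hVre
      exact (continuousOn_const.mul (hB.mono hs)).div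
        (continuousOn_const.add (continuousOn_const.mul (hA.mono hs)))
        fun p hp => hden0 p.1 p.2 hp.2
    set ℓ := m / ρ with hℓ
    have hGℓ : ∀ t, ∀ z ∈ U', ∀ z' ∈ U', ‖G t z - G t z'‖ ≤ ℓ * ‖z - z'‖ := by
      intro t z hz z' hz'
      refine Convex.norm_image_sub_le_of_norm_deriv_le (𝕜 := ℂ) (s := U') (fun y hy => ?_)
        (fun y hy => ?_) (hKconv.thickening _) hz' hz
      · exact ((hGd t).mono hU'V).differentiableAt (isOpen_thickening.mem_nhds hy)
      · refine Complex.norm_deriv_le_of_forall_mem_sphere_norm_le hρ0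
          (DifferentiableOn.diffContOnCl ?_)
          fun u hu => hGm t u (hball y hy (sphere_subset_closedBall hu))
        rw [closure_ball _ hρ0.ne']
        exact (hGd t).mono (hball y hy)
    have hm0 : 0 ≤ m := by positivity
    have hmT : m * (2 * Real.pi) ≤ ρ := by
      have : 0 ≤ |ε| * M := by positivity
      nlinarith
    have hℓT : ℓ * (2 * Real.pi) ≤ 1 / 2 := by
      rw [hℓ, div_mul_eq_mul_div, div_le_iff₀ hρ0]
      linarith
    obtain ⟨D, hDd, hDe, hDW⟩ := exists_holomorphic_increment (G := G) (T := 2 * Real.pi)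
      (m := m) (ℓ := ℓ) (U := U) (U' := U') (by positivity) isOpen_thickening
      (fun w hw z hz => hUU' w hw z (hz.trans hmT)) hm0 (fun t z hz => hGm t z (hU'V hz))
      (hGc.mono (prod_mono le_rfl hU'V)) (fun t => (hGd t).mono hU'V) (by positivity) hGℓ hℓT
    refine ⟨fun w => D w / ε, fun t x hx => hεA t _ (hUV (hKU x hx)),
      ⟨ℓ, fun t x hx y hy => ?_⟩, hDd.div_const _, fun w hw => ?_, fun W hW hper => ?_⟩
    · have := hGℓ t x (hKU' x hx) y (hKU' y hy)
      rwa [← Complex.ofReal_sub, Complex.norm_real, Real.norm_eq_abs] at this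
    · have hwV := hUV hw
      have hBi : Continuous fun t => B t w :=
        hB.comp_continuous (by fun_prop : Continuous fun t : ℝ => (t, w))
          fun t => ⟨trivial, hVre hwV⟩
      have hGi : Continuous fun t => G t w :=
        hGc.comp_continuous (by fun_prop : Continuous fun t : ℝ => (t, w))
          fun t => ⟨trivial, hwV⟩
      have h1 : D w / ε - ∫ t in (0 : ℝ)..(2 * Real.pi), B t w
          = (D w - ∫ t in (0 : ℝ)..(2 * Real.pi), G t w) / ε
            + ∫ t in (0 : ℝ)..(2 * Real.pi), (G t w / ε - B t w) := by
        rw [integral_sub ((hGi.div_const _).intervalIntegrable _ _)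
          (hBi.intervalIntegrable _ _), integral_div]
        ring
      have h2 : ‖∫ t in (0 : ℝ)..(2 * Real.pi), (G t w / ε - B t w)‖
          ≤ 2 * M ^ 2 * |ε| * |2 * Real.pi - 0| := by
        refine norm_integral_le_of_norm_le_const fun t _ => ?_
        have h3 : G t w / ε - B t w = -((ε : ℂ) * A t w * B t w) / (1 + (ε : ℂ) * A t w) := by
          have := hden0 t w hwV
          rw [hG]
          field_simp
          ring
        rw [h3, norm_div, norm_neg, norm_mul, norm_mul, hnε,
          div_le_iff₀ (by linarith [hden t w hwV])]
        have h4 : |ε| * ‖A t w‖ * ‖B t w‖ ≤ |ε| * M * M := by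
          gcongr
          · exact hMA t w hwV
          · exact hMB t w hwV
        have h5 : 0 ≤ M ^ 2 * |ε| := by positivity
        nlinarith [hden t w hwV]
      rw [sub_zero, abs_of_pos Real.two_pi_pos] at h2
      rw [h1]
      refine (norm_add_le _ _).trans ((add_le_add (le_of_eq (norm_div _ _)) h2).trans ?_)
      have h6 : ‖D w - ∫ t in (0 : ℝ)..(2 * Real.pi), G t w‖ / ‖(ε : ℂ)‖
          ≤ ℓ * (2 * Real.pi) * (m * (2 * Real.pi)) / |ε| := by
        rw [hnε]
        gcongr
        exact hDe w hw
      refine (add_le_add h6 le_rfl).trans (le_of_eq ?_)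
      rw [hℓ, hm, hC]
      field_simp
    · have hWc : Continuous fun t => (W t : ℂ) :=
        continuous_iff_continuousAt.2 fun t => (hW t).2.continuousAt
      have hWU : ∀ t, (W t : ℂ) ∈ U' := fun t => hKU' _ (hW t).1
      have hGW : Continuous fun t => G t (W t) :=
        hGc.comp_continuous (continuous_id.prodMk hWc) fun t => ⟨trivial, hU'V (hWU t)⟩
      have h1 := hDW (W 0) (hKU _ (hW 0).1) (fun t => (W t : ℂ)) hWc hWU fun t _ => by
        rw [integral_eq_sub_of_hasDerivAt (fun s _ => (hW s).2) (hGW.intervalIntegrable _ _)]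
        ring
      rw [hper] at h1
      have h2 : D (W 0) = 0 := by simpa using h1
      simp [h2]
  choose! D hD using main
  exact ⟨U, C, ε₁, D, isOpen_thickening, hKU, hUV.trans hVre, by positivity, hD⟩

end CubicIsochronous

/-! ### Complexification of the system in polar coordinates -/

namespace CubicIsochronous

/-- The complexified polar radius; the principal branch of the power is holomorphic where it is
used, as `Re w > 1`. -/
noncomputable def complexRadius (t : ℝ) (w : ℂ) : ℂ := (w - (Real.sin (2 * t) : ℂ)) ^ (-(1 / 2) : ℂ)

/-- The holomorphic extension of `angularPart` to complex `w`. -/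
noncomputable def complexAngularPart (f g : MvPolynomial (Fin 2) ℝ) (t : ℝ) (w : ℂ) : ℂ :=
  (w - (Real.sin (2 * t) : ℂ)) *
    (complexRadius t w * (Real.cos t : ℂ) * MvPolynomial.aeval
        ![complexRadius t w * (Real.cos t : ℂ), complexRadius t w * (Real.sin t : ℂ)] g
      - complexRadius t w * (Real.sin t : ℂ) * MvPolynomial.aeval
        ![complexRadius t w * (Real.cos t : ℂ), complexRadius t w * (Real.sin t : ℂ)] f)

/-- The holomorphic extension of `radialPart` to complex `w`. -/
noncomputable def complexRadialPart (f g : MvPolynomial (Fin 2) ℝ) (t : ℝ) (w : ℂ) : ℂ :=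
  2 * (w - (Real.sin (2 * t) : ℂ)) *
    ((complexRadius t w * (Real.sin t : ℂ) - w * (complexRadius t w * (Real.cos t : ℂ)))
        * MvPolynomial.aeval
          ![complexRadius t w * (Real.cos t : ℂ), complexRadius t w * (Real.sin t : ℂ)] f
      + (complexRadius t w * (Real.cos t : ℂ) - w * (complexRadius t w * (Real.sin t : ℂ)))
        * MvPolynomial.aeval
          ![complexRadius t w * (Real.cos t : ℂ), complexRadius t w * (Real.sin t : ℂ)] g)

lemma complexRadius_ofReal {w : ℝ} (hw : 1 < w) (t : ℝ) :
    complexRadius t w = (polarRadius w t : ℂ) := by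
  have h := (sub_sin_pos hw t).le
  rw [polarRadius, Real.sqrt_eq_rpow, one_div, Real.inv_rpow h, ← Real.rpow_neg h,
    Complex.ofReal_cpow h, complexRadius]
  push_cast
  rfl

lemma aeval_ofReal (f : MvPolynomial (Fin 2) ℝ) (x y : ℝ) :
    MvPolynomial.aeval ![(x : ℂ), (y : ℂ)] f = (MvPolynomial.eval ![x, y] f : ℂ) := by
  have h := MvPolynomial.aeval_algebraMap_apply (A := ℝ) ℂ ![x, y] f
  have h2 : (algebraMap ℝ ℂ) ∘ ![x, y] = ![(x : ℂ), (y : ℂ)] := by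
    funext i
    fin_cases i <;> rfl
  rw [h2] at h
  exact h

lemma complexAngularPart_ofReal (f g : MvPolynomial (Fin 2) ℝ) {w : ℝ} (hw : 1 < w) (t : ℝ) :
    complexAngularPart f g t w = (angularPart f g t w : ℂ) := by
  rw [complexAngularPart, complexRadius_ofReal hw, ← Complex.ofReal_mul, ← Complex.ofReal_mul,
    aeval_ofReal, aeval_ofReal, angularPart]
  simp [polarPoint]

lemma complexRadialPart_ofReal (f g : MvPolynomial (Fin 2) ℝ) {w : ℝ} (hw : 1 < w) (t : ℝ) :
    complexRadialPart f g t w = (radialPart f g t w : ℂ) := by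
  rw [complexRadialPart, complexRadius_ofReal hw, ← Complex.ofReal_mul, ← Complex.ofReal_mul,
    aeval_ofReal, aeval_ofReal, radialPart]
  simp [polarPoint]

lemma aeval_eq_sum (f : MvPolynomial (Fin 2) ℝ) (x y : ℂ) :
    MvPolynomial.aeval ![x, y] f
      = ∑ d ∈ f.support, ((f.coeff d : ℝ) : ℂ) * (x ^ d 0 * y ^ d 1) := by
  rw [MvPolynomial.aeval_def, MvPolynomial.eval₂_eq']
  simp [Fin.prod_univ_two]

lemma sub_sin_mem_slitPlane {w : ℂ} (hw : 1 < w.re) (t : ℝ) :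
    w - (Real.sin (2 * t) : ℂ) ∈ Complex.slitPlane := by
  refine Complex.mem_slitPlane_iff.2 (Or.inl ?_)
  rw [Complex.sub_re, Complex.ofReal_re]
  linarith [Real.sin_le_one (2 * t)]

lemma continuousOn_complexRadius :
    ContinuousOn (Function.uncurry complexRadius) (univ ×ˢ {z : ℂ | 1 < z.re}) :=
  ContinuousOn.cpow (by fun_prop) continuousOn_const
    fun p hp => sub_sin_mem_slitPlane hp.2 p.1

lemma differentiableOn_complexRadius (t : ℝ) :
    DifferentiableOn ℂ (complexRadius t) {z : ℂ | 1 < z.re} :=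
  DifferentiableOn.cpow (by fun_prop) (by fun_prop) fun _ hz => sub_sin_mem_slitPlane hz t

variable (f g : MvPolynomial (Fin 2) ℝ)

lemma continuousOn_complexAngularPart :
    ContinuousOn (Function.uncurry (complexAngularPart f g)) (univ ×ˢ {z : ℂ | 1 < z.re}) := by
  have h : ContinuousOn (fun p : ℝ × ℂ => complexRadius p.1 p.2) (univ ×ˢ {z : ℂ | 1 < z.re}) :=
    continuousOn_complexRadius
  simp only [Function.uncurry_def, complexAngularPart, aeval_eq_sum]
  fun_prop

lemma continuousOn_complexRadialPart :
    ContinuousOn (Function.uncurry (complexRadialPart f g)) (univ ×ˢ {z : ℂ | 1 < z.re}) := by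
  have h : ContinuousOn (fun p : ℝ × ℂ => complexRadius p.1 p.2) (univ ×ˢ {z : ℂ | 1 < z.re}) :=
    continuousOn_complexRadius
  simp only [Function.uncurry_def, complexRadialPart, aeval_eq_sum]
  fun_prop

lemma differentiableOn_complexAngularPart (t : ℝ) :
    DifferentiableOn ℂ (complexAngularPart f g t) {z : ℂ | 1 < z.re} := by
  have h : DifferentiableOn ℂ (fun w => complexRadius t w) {z : ℂ | 1 < z.re} :=
    differentiableOn_complexRadius t
  change DifferentiableOn ℂ (fun w => complexAngularPart f g t w) _
  simp only [complexAngularPart, aeval_eq_sum]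
  fun_prop

lemma differentiableOn_complexRadialPart (t : ℝ) :
    DifferentiableOn ℂ (complexRadialPart f g t) {z : ℂ | 1 < z.re} := by
  have h : DifferentiableOn ℂ (fun w => complexRadius t w) {z : ℂ | 1 < z.re} :=
    differentiableOn_complexRadius t
  change DifferentiableOn ℂ (fun w => complexRadialPart f g t w) _
  simp only [complexRadialPart, aeval_eq_sum]
  fun_prop

lemma sin_two_mul_add_two_pi (t : ℝ) :
    Real.sin (2 * (t + 2 * Real.pi)) = Real.sin (2 * t) := by
  rw [show 2 * (t + 2 * Real.pi) = 2 * t + 2 * Real.pi + 2 * Real.pi by ring,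
    Real.sin_add_two_pi, Real.sin_add_two_pi]

lemma periodic_complexAngularPart :
    Function.Periodic (complexAngularPart f g) (2 * Real.pi) := fun t => by
  funext w
  simp only [complexAngularPart, complexRadius, sin_two_mul_add_two_pi, Real.sin_add_two_pi,
    Real.cos_add_two_pi]

lemma periodic_complexRadialPart :
    Function.Periodic (complexRadialPart f g) (2 * Real.pi) := fun t => by
  funext w
  simp only [complexRadialPart, complexRadius, sin_two_mul_add_two_pi, Real.sin_add_two_pi,
    Real.cos_add_two_pi]

lemma periodic_angularPart : Function.Periodic (angularPart f g) (2 * Real.pi) := fun t => by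
  funext w
  simp only [angularPart, polarPoint, polarRadius, sin_two_mul_add_two_pi, Real.sin_add_two_pi,
    Real.cos_add_two_pi]

lemma periodic_radialPart : Function.Periodic (radialPart f g) (2 * Real.pi) := fun t => by
  funext w
  simp only [radialPart, polarPoint, polarRadius, sin_two_mul_add_two_pi, Real.sin_add_two_pi,
    Real.cos_add_two_pi]

end CubicIsochronous

/-! ### Periodic orbits in polar coordinates -/

namespace CubicIsochronous

open Filter Topology intervalIntegral

/-- A differentiable planar curve that avoids the origin has a differentiable polar angle. -/
lemma exists_polar_angle {x y x' y' : ℝ → ℝ} (hx : ∀ t, HasDerivAt x (x' t) t)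
    (hy : ∀ t, HasDerivAt y (y' t) t) (hx' : Continuous x') (hy' : Continuous y')
    (h0 : ∀ t, x t ^ 2 + y t ^ 2 ≠ 0) :
    ∃ θ : ℝ → ℝ, ∀ t,
      HasDerivAt θ ((x t * y' t - y t * x' t) / (x t ^ 2 + y t ^ 2)) t ∧
      x t = √(x t ^ 2 + y t ^ 2) * Real.cos (θ t) ∧
      y t = √(x t ^ 2 + y t ^ 2) * Real.sin (θ t) := by
  have hxc : Continuous x := continuous_iff_continuousAt.2 fun t => (hx t).continuousAt
  have hyc : Continuous y := continuous_iff_continuousAt.2 fun t => (hy t).continuousAt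
  -- a logarithm of the curve, as a primitive of its logarithmic derivative
  set z : ℝ → ℂ := fun t => (x t : ℂ) + (y t : ℂ) * Complex.I with hz
  set z' : ℝ → ℂ := fun t => (x' t : ℂ) + (y' t : ℂ) * Complex.I with hz'
  have hzd : ∀ t, HasDerivAt z (z' t) t := fun t =>
    ((hx t).ofReal_comp).add (((hy t).ofReal_comp).mul_const Complex.I)
  have hzn : ∀ t, ‖z t‖ = √(x t ^ 2 + y t ^ 2) := fun t => by
    rw [hz, Complex.norm_add_mul_I]
  have hz0 : ∀ t, z t ≠ 0 := fun t h => by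
    have h1 := hzn t
    rw [h, norm_zero] at h1
    have h2 : 0 < x t ^ 2 + y t ^ 2 := lt_of_le_of_ne (by positivity) (h0 t).symm
    exact (Real.sqrt_pos.2 h2).ne h1
  have hq : Continuous fun t => z' t / z t := by
    have h1 : Continuous z := by fun_prop
    have h2 : Continuous z' := by fun_prop
    exact h2.div h1 hz0
  set L : ℝ → ℂ := fun t => ∫ s in (0 : ℝ)..t, z' s / z s with hL
  have hLd : ∀ t, HasDerivAt L (z' t / z t) t := fun t =>
    integral_hasDerivAt_right (hq.intervalIntegrable _ _)
      (hq.stronglyMeasurableAtFilter _ _) hq.continuousAt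
  have hconst : ∀ t, z t = z 0 * Complex.exp (L t) := by
    have hd : ∀ t, HasDerivAt (fun t => z t * Complex.exp (-L t)) 0 t := fun t => by
      refine ((hzd t).mul ((hLd t).neg.cexp)).congr_deriv ?_
      have := hz0 t
      field_simp
      ring
    intro t
    have h1 := is_const_of_deriv_eq_zero (fun t => (hd t).differentiableAt)
      (fun t => (hd t).deriv) t 0
    have hL0 : L 0 = 0 := by simp [hL]
    rw [hL0, neg_zero, Complex.exp_zero, mul_one, Complex.exp_neg] at h1
    rw [← h1, inv_mul_cancel_right₀ (Complex.exp_ne_zero _)]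
  refine ⟨fun t => (z 0).arg + (L t).im, fun t => ?_⟩
  have h2 : z t = ‖z t‖ * Complex.exp (((z 0).arg + (L t).im : ℝ) * Complex.I) := by
    rw [hconst t, norm_mul, Complex.norm_exp]
    conv_lhs => rw [← Complex.norm_mul_exp_arg_mul_I (z 0), mul_assoc, ← Complex.exp_add]
    push_cast
    rw [mul_assoc, ← Complex.exp_add]
    congr 2
    conv_lhs => rw [← Complex.re_add_im (L t)]
    ring
  rw [hzn, Complex.exp_mul_I, ← Complex.ofReal_cos, ← Complex.ofReal_sin] at h2
  refine ⟨?_, ?_, ?_⟩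
  · have h3 := (Complex.imCLM.hasFDerivAt.comp_hasDerivAt t (hLd t)).const_add (z 0).arg
    refine h3.congr_deriv ?_
    have h4 : Complex.normSq (z t) = x t ^ 2 + y t ^ 2 := by
      rw [hz, Complex.normSq_add_mul_I]
    simp only [Complex.imCLM_apply, Complex.div_im, h4]
    simp [hz, hz']
    ring
  · change _ = _ * Real.cos ((z 0).arg + (L t).im)
    generalize (z 0).arg + (L t).im = a at h2 ⊢
    have := congrArg Complex.re h2
    simpa [hz, -Complex.ofReal_cos, -Complex.ofReal_sin] using this
  · change _ = _ * Real.sin ((z 0).arg + (L t).im)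
    generalize (z 0).arg + (L t).im = a at h2 ⊢
    have := congrArg Complex.im h2
    simpa [hz, -Complex.ofReal_cos, -Complex.ofReal_sin] using this

/-- In the coordinates `θ` and `w = 1 / H`, a periodic orbit in a part `K` of the plane where
`1 / H` takes values in `[α, β]` and the angular velocity is positive, is the graph of a solution
`W` of the scalar equation `dw/dθ = ε radialPart / (1 + ε angularPart)`, which returns to its
initial value after some number of turns. -/
lemma exists_graph_of_isPeriodicOrbit (f g : MvPolynomial (Fin 2) ℝ) {ε α β : ℝ}
    {K C : Set (ℝ × ℝ)}
    (hK : ∀ p ∈ K, p.1 ^ 2 + p.2 ^ 2 ≠ 0 ∧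
      (1 + 2 * p.1 * p.2) / (p.1 ^ 2 + p.2 ^ 2) ∈ Icc α β)
    (hε : ∀ t, ∀ w ∈ Icc α β, |ε * angularPart f g t w| ≤ 1 / 2)
    (hC : IsPeriodicOrbit (field f g ε) C) (hCK : C ⊆ K) :
    ∃ W : ℝ → ℝ, (∀ t, W t ∈ Icc α β ∧ HasDerivAt W
        (ε * radialPart f g t (W t) / (1 + ε * angularPart f g t (W t))) t) ∧
      (∃ k : ℕ, 0 < k ∧ W (k * (2 * Real.pi)) = W 0) ∧
      C = range fun t => polarPoint (W t) t := by
  obtain ⟨γ, T, hT, hγ, hper, -, rfl⟩ := hC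
  have hmem : ∀ t, γ t ∈ K := fun t => hCK ⟨t, rfl⟩
  set x : ℝ → ℝ := fun t => (γ t).1 with hx
  set y : ℝ → ℝ := fun t => (γ t).2 with hy
  have hxd : ∀ t, HasDerivAt x (field f g ε (γ t)).1 t := fun t =>
    (hasFDerivAt_fst (𝕜 := ℝ) (E := ℝ) (F := ℝ)).comp_hasDerivAt t (hγ t)
  have hyd : ∀ t, HasDerivAt y (field f g ε (γ t)).2 t := fun t =>
    (hasFDerivAt_snd (𝕜 := ℝ) (E := ℝ) (F := ℝ)).comp_hasDerivAt t (hγ t)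
  have hγc : Continuous γ := continuous_iff_continuousAt.2 fun t => (hγ t).continuousAt
  have hXc : Continuous (field f g ε) := by
    change Continuous fun p => field f g ε p
    simp only [field, eval_eq_sum]
    fun_prop
  have hr0 : ∀ t, x t ^ 2 + y t ^ 2 ≠ 0 := fun t => (hK _ (hmem t)).1
  have hrpos : ∀ t, 0 < x t ^ 2 + y t ^ 2 := fun t =>
    lt_of_le_of_ne (by positivity) (hr0 t).symm
  obtain ⟨θ, hθ⟩ := exists_polar_angle hxd hyd (hXc.comp hγc).fst (hXc.comp hγc).snd hr0
  set w : ℝ → ℝ := fun t => (1 + 2 * x t * y t) / (x t ^ 2 + y t ^ 2) with hw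
  have hwmem : ∀ t, w t ∈ Icc α β := fun t => (hK _ (hmem t)).2
  have hsub : ∀ t, w t - Real.sin (2 * θ t) = 1 / (x t ^ 2 + y t ^ 2) := fun t => by
    have h1 := (hθ t).2.1
    have h2 := (hθ t).2.2
    have h3 : √(x t ^ 2 + y t ^ 2) ^ 2 = x t ^ 2 + y t ^ 2 := Real.sq_sqrt (hrpos t).le
    have h4 : Real.sin (2 * θ t) * (x t ^ 2 + y t ^ 2) = 2 * x t * y t := by
      rw [Real.sin_two_mul]
      have h5 : x t * y t
          = √(x t ^ 2 + y t ^ 2) ^ 2 * (Real.cos (θ t) * Real.sin (θ t)) := by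
        nth_rewrite 1 [h1]
        nth_rewrite 2 [h2]
        ring
      rw [h3] at h5
      linear_combination -2 * h5
    rw [eq_div_iff (hr0 t), sub_mul, h4, hw, div_mul_cancel₀ _ (hr0 t)]
    ring
  have hrad : ∀ t, polarRadius (w t) (θ t) = √(x t ^ 2 + y t ^ 2) := fun t => by
    rw [polarRadius, hsub, one_div_one_div]
  have hpt : ∀ t, polarPoint (w t) (θ t) = γ t := fun t => by
    rw [polarPoint, hrad, ← (hθ t).2.1, ← (hθ t).2.2]
  have hθd : ∀ t, HasDerivAt θ (1 + ε * angularPart f g (θ t) (w t)) t := fun t => by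
    refine (hθ t).1.congr_deriv ?_
    have := hr0 t
    rw [angularPart, hsub, hpt]
    change (x t * _ - y t * _) / _ = 1 + ε * (_ * (x t * _ - y t * _))
    simp only [field]
    change (x t * (x t + x t ^ 2 * y t - y t ^ 3 + _)
      - y t * (-y t + x t ^ 3 - x t * y t ^ 2 + _)) / _ = _
    field_simp
    ring
  have hwd : ∀ t, HasDerivAt w (ε * radialPart f g (θ t) (w t)) t := fun t => by
    have h1 := ((((hxd t).const_mul 2).mul (hyd t)).const_add 1).div
      (((hxd t).pow 2).add ((hyd t).pow 2)) (hr0 t)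
    refine h1.congr_deriv ?_
    have := hr0 t
    rw [radialPart, hsub, hpt]
    simp only [field, hw]
    generalize MvPolynomial.eval _ f = F
    generalize MvPolynomial.eval _ g = G
    change _ = ε * (2 * _ * ((y t - _ * x t) * F + (x t - _ * y t) * G))
    simp only [Pi.add_apply, Pi.mul_apply, Pi.pow_apply]
    change (((2 * (-y t + x t ^ 3 - x t * y t ^ 2 + ε * F)) * y t
      + 2 * x t * (x t + x t ^ 2 * y t - y t ^ 3 + ε * G)) * (x t ^ 2 + y t ^ 2)
      - (1 + 2 * x t * y t) * _) / _ = _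
    field_simp
    push_cast
    ring
  -- the angle is an increasing bijection of the line
  have hlow : ∀ t, 1 / 2 ≤ 1 + ε * angularPart f g (θ t) (w t) := fun t => by
    linarith [(abs_le.1 (hε (θ t) (w t) (hwmem t))).1]
  have hmono : Monotone fun t => θ t - t / 2 := by
    have hd : ∀ t, HasDerivAt (fun t => θ t - t / 2)
        (1 + ε * angularPart f g (θ t) (w t) - 1 / 2) t := fun t =>
      (hθd t).sub ((hasDerivAt_id t).div_const 2)
    refine monotone_of_deriv_nonneg (fun t => (hd t).differentiableAt) fun t => ?_
    rw [(hd t).deriv]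
    linarith [hlow t]
  have hθc : Continuous θ := continuous_iff_continuousAt.2 fun t => (hθd t).continuousAt
  have hθmono : StrictMono θ := fun s t hst => by
    have := hmono hst.le
    simp only at this
    linarith
  have hθsurj : Function.Surjective θ := by
    refine hθc.surjective ?_ ?_
    · have h1 : Tendsto (fun t : ℝ => θ 0 + t / 2) atTop atTop :=
        tendsto_atTop_add_const_left _ _ (tendsto_id.atTop_div_const (by norm_num))
      refine tendsto_atTop_mono' _ ?_ h1
      filter_upwards [eventually_ge_atTop 0] with t ht
      have := hmono ht
      simp only at this
      linarith
    · have h1 : Tendsto (fun t : ℝ => θ 0 + t / 2) atBot atBot :=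
        tendsto_atBot_add_const_left _ _ (tendsto_id.atBot_div_const (by norm_num))
      refine tendsto_atBot_mono' _ ?_ h1
      filter_upwards [eventually_le_atBot 0] with t ht
      have := hmono ht
      simp only at this
      linarith
  set e : ℝ ≃o ℝ := hθmono.orderIsoOfSurjective θ hθsurj with he
  have heθ : ∀ t, e t = θ t := fun t => rfl
  have hθe : ∀ s, θ (e.symm s) = s := fun s => e.apply_symm_apply s
  refine ⟨fun s => w (e.symm s), fun s => ⟨hwmem _, ?_⟩, ?_, ?_⟩
  · have h1 : HasDerivAt e.symm (1 + ε * angularPart f g (θ (e.symm s)) (w (e.symm s)))⁻¹ s :=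
      HasDerivAt.of_local_left_inverse e.symm.continuous.continuousAt (hθd (e.symm s))
        (by linarith [hlow (e.symm s)]) (Eventually.of_forall hθe)
    have h2 := (hwd (e.symm s)).comp s h1
    rw [hθe] at h2
    exact h2
  · set t₀ := e.symm 0 with ht₀
    have h1 : γ (t₀ + T) = γ t₀ := hper t₀
    have hxT : x (t₀ + T) = x t₀ := by simp only [hx, h1]
    have hyT : y (t₀ + T) = y t₀ := by simp only [hy, h1]
    have hwT : w (t₀ + T) = w t₀ := by simp only [hw, hxT, hyT]
    have hθ0 : θ t₀ = 0 := hθe 0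
    have hc := (hθ (t₀ + T)).2.1
    have hc0 := (hθ t₀).2.1
    rw [hxT, hyT] at hc
    have hcos : Real.cos (θ (t₀ + T)) = 1 := by
      have h2 := hc.symm.trans hc0
      rw [hθ0, Real.cos_zero] at h2
      exact mul_left_cancel₀ (Real.sqrt_pos.2 (hrpos t₀)).ne' h2
    obtain ⟨k, hk⟩ := (Real.cos_eq_one_iff _).1 hcos
    have hpos : 0 < θ (t₀ + T) := by
      rw [← hθ0]
      exact hθmono (by linarith)
    have hk0 : 0 < k := by
      rw [← hk] at hpos
      have := (mul_pos_iff_of_pos_right Real.two_pi_pos).1 hpos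
      exact_mod_cast this
    refine ⟨k.toNat, by omega, ?_⟩
    have hkc : ((k.toNat : ℕ) : ℝ) = (k : ℝ) := by
      rw [← Int.cast_natCast, Int.toNat_of_nonneg hk0.le]
    change w (e.symm _) = w (e.symm 0)
    rw [hkc, hk, ← heθ, e.symm_apply_apply]
    exact hwT
  · ext p
    constructor
    · rintro ⟨t, rfl⟩
      exact ⟨θ t, by simp only [← heθ, e.symm_apply_apply]; exact hpt t⟩
    · rintro ⟨s, rfl⟩
      refine ⟨e.symm s, ?_⟩
      rw [← hpt, hθe]

end CubicIsochronous

/-! ### Counting zeros and periodic orbits -/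

namespace CubicIsochronous

open Polynomial

/-- A polynomial that is locally a continuous multiple of a product of linear factors, repetitions
allowed, is divisible by that product. -/
lemma prod_X_sub_C_dvd_of_eq_prod_mul {m : ℕ} {R : ℝ[X]} {S : Set ℝ} (hS : IsOpen S)
    {c : Fin m → ℝ} (hc : ∀ i, c i ∈ S) {g : ℝ → ℂ} (hg : ContinuousOn g S)
    (h : ∀ x ∈ S, ((R.eval x : ℝ) : ℂ) = (∏ i, ((x : ℂ) - c i)) * g x) :
    (∏ i, (X - C (c i))) ∣ R := by
  induction m generalizing R with
  | zero => simp
  | succ m ih =>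
    have h0 : R.eval (c 0) = 0 := by
      have := h (c 0) (hc 0)
      rw [Fin.prod_univ_succ, sub_self, zero_mul, zero_mul] at this
      exact_mod_cast this
    obtain ⟨R', rfl⟩ := dvd_iff_isRoot.2 h0
    rw [Fin.prod_univ_succ]
    refine mul_dvd_mul_left _ (ih (fun i => hc i.succ) ?_)
    have hne : ∀ x ∈ S, x ≠ c 0 →
        ((R'.eval x : ℝ) : ℂ) = (∏ i : Fin m, ((x : ℂ) - c i.succ)) * g x := by
      intro x hx hxc
      have h1 := h x hx
      rw [Fin.prod_univ_succ, eval_mul, eval_sub, eval_X, eval_C] at h1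
      push_cast at h1
      have h2 : (x : ℂ) - c 0 ≠ 0 := by
        rw [sub_ne_zero]
        exact_mod_cast hxc
      rw [mul_assoc] at h1
      exact mul_left_cancel₀ h2 h1
    intro x hx
    by_cases hxc : x = c 0
    · -- at the zero itself the identity follows by continuity
      subst hxc
      have hl : ContinuousOn (fun x : ℝ => ((R'.eval x : ℝ) : ℂ)) S :=
        (Complex.continuous_ofReal.comp R'.continuous).continuousOn
      have hr : ContinuousOn (fun x : ℝ => (∏ i : Fin m, ((x : ℂ) - c i.succ)) * g x) S := by
        fun_prop
      have hl' := (hl.continuousAt (hS.mem_nhds hx)).tendsto.mono_left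
        (nhdsWithin_le_nhds (s := {c 0}ᶜ))
      have hr' := (hr.continuousAt (hS.mem_nhds hx)).tendsto.mono_left
        (nhdsWithin_le_nhds (s := {c 0}ᶜ))
      refine tendsto_nhds_unique (hl'.congr' ?_) hr'
      filter_upwards [self_mem_nhdsWithin, mem_nhdsWithin_of_mem_nhds (hS.mem_nhds hx)] with
        y hy hyS
      exact hne y hyS hy
    · exact hne x hx hxc

/-- A function `A + Q √(w² - 1)` with `deg A ≤ d`, `deg Q < d` that does not vanish identically
has on `(1, ∞)` at most `2 d` zeros, counted with multiplicity, because these are zeros of the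
polynomial `A² - Q² (w² - 1)`. -/
lemma IsSqrtPoly.card_zeros_le {d m : ℕ} {F : ℝ → ℝ} (hF : IsSqrtPoly d F)
    (hne : ∃ w, 1 < w ∧ F w ≠ 0) {S : Set ℝ} (hS : IsOpen S) (hS1 : S ⊆ Ioi 1)
    {c : Fin m → ℝ} (hc : ∀ i, c i ∈ S) {g : ℝ → ℂ} (hg : ContinuousOn g S)
    (h : ∀ x ∈ S, (F x : ℂ) = (∏ i, ((x : ℂ) - c i)) * g x) : m ≤ 2 * d := by
  obtain ⟨A, hA, Q, hQ, hFe⟩ := hF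
  have hA' : A.natDegree ≤ d := by
    rcases eq_or_ne A 0 with rfl | hA0
    · simp
    · exact Nat.lt_succ_iff.1 ((natDegree_lt_iff_degree_lt hA0).2 (mem_degreeLT.1 hA))
  set R := A ^ 2 - Q ^ 2 * (X ^ 2 - 1) with hR
  have hR0 : R ≠ 0 := by
    intro hR0
    have hAQ : ∀ x ∈ Ioo (-1 : ℝ) 1, A.eval x = 0 ∧ Q.eval x = 0 := by
      intro x hx
      have h1 : A.eval x ^ 2 - Q.eval x ^ 2 * (x ^ 2 - 1) = 0 := by
        have := congrArg (eval x) hR0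
        simpa [hR] using this
      have h2 : 0 < 1 - x ^ 2 := by nlinarith [hx.1, hx.2]
      have h3 : 0 ≤ Q.eval x ^ 2 * (1 - x ^ 2) := by positivity
      have h4 : A.eval x ^ 2 = 0 := by nlinarith [sq_nonneg (A.eval x)]
      have h5 : Q.eval x ^ 2 * (1 - x ^ 2) = 0 := by nlinarith
      exact ⟨by simpa using h4, by simpa [h2.ne'] using h5⟩
    have hinf : (Ioo (-1 : ℝ) 1).Infinite := Ioo_infinite (by norm_num)
    have hA0 : A = 0 := eq_zero_of_infinite_isRoot A (hinf.mono fun x hx => (hAQ x hx).1)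
    have hQ0 : Q = 0 := eq_zero_of_infinite_isRoot Q (hinf.mono fun x hx => (hAQ x hx).2)
    obtain ⟨w, hw, hFw⟩ := hne
    exact hFw (by simp [hFe w hw, hA0, hQ0])
  have hdeg : R.natDegree ≤ 2 * d := by
    refine (natDegree_sub_le _ _).trans (max_le ?_ ?_)
    · exact (natDegree_pow_le_of_le 2 hA')
    · rcases eq_or_ne Q 0 with rfl | hQ0
      · simp
      · have hQ' : Q.natDegree < d := (natDegree_lt_iff_degree_lt hQ0).2 (mem_degreeLT.1 hQ)
        have h1 : (X ^ 2 - 1 : ℝ[X]).natDegree ≤ 2 := natDegree_X_pow_sub_C.le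
        have h2 := natDegree_pow_le_of_le 2 (Nat.le_sub_one_of_lt hQ')
        have h3 := natDegree_mul_le (p := Q ^ 2) (q := (X ^ 2 - 1 : ℝ[X]))
        omega
  have hdvd : (∏ i, (X - C (c i))) ∣ R := by
    refine prod_X_sub_C_dvd_of_eq_prod_mul hS hc
      (g := fun x => g x * ((A.eval x - Q.eval x * √(x ^ 2 - 1) : ℝ) : ℂ)) ?_ fun x hx => ?_
    · refine hg.mul (Complex.continuous_ofReal.comp ?_).continuousOn
      have := A.continuous
      have := Q.continuous
      fun_prop
    · have hx1 := hS1 hx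
      rw [← mul_assoc, ← h x hx, ← Complex.ofReal_mul, hFe x hx1]
      congr 1
      have h1 : √(x ^ 2 - 1) ^ 2 = x ^ 2 - 1 := Real.sq_sqrt (by nlinarith [mem_Ioi.1 hx1])
      simp only [hR, eval_sub, eval_mul, eval_pow, eval_X, eval_one]
      linear_combination Q.eval x ^ 2 * h1
  have h1 := natDegree_le_of_dvd hdvd hR0
  rw [natDegree_finsetProd_X_sub_C_eq_card, Finset.card_univ, Fintype.card_fin] at h1
  omega

open Filter Topology

/-- A solution of a periodic scalar equation that returns after several periods returns after one:
by uniqueness, the return map is increasing. -/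
lemma eq_of_return {F : ℝ → ℝ → ℝ} {τ : ℝ} (hp : Function.Periodic F τ) {S : Set ℝ}
    {L : NNReal} (hL : ∀ t, LipschitzOnWith L (F t) S) {W : ℝ → ℝ}
    (hW : ∀ t, HasDerivAt W (F t (W t)) t ∧ W t ∈ S) {k : ℕ} (hk : 0 < k)
    (h : W (k * τ) = W 0) : W τ = W 0 := by
  have hW1 : ∀ t, HasDerivAt (fun t => W (t + τ)) (F t (W (t + τ))) t ∧ W (t + τ) ∈ S :=
    fun t => ⟨by
      have := (hW (t + τ)).1.comp_add_const t τ
      rwa [hp] at this, (hW (t + τ)).2⟩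
  by_cases hex : ∃ t, W (t + τ) = W t
  · obtain ⟨t₀, ht₀⟩ := hex
    have := congrFun (ODE_solution_unique_univ (s := fun _ => S) hL hW1 hW ht₀) 0
    simpa using this
  · exfalso
    push Not at hex
    have hWc : Continuous W := continuous_iff_continuousAt.2 fun t => (hW t).1.continuousAt
    have hd : Continuous fun t => W (t + τ) - W t := by fun_prop
    have hsign : (∀ t, W t < W (t + τ)) ∨ (∀ t, W (t + τ) < W t) := by
      by_contra hcon
      push Not at hcon
      obtain ⟨⟨a, ha⟩, ⟨b, hb⟩⟩ := hcon
      obtain ⟨t, ht⟩ := mem_range_of_exists_le_of_exists_ge hd (c := 0)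
        ⟨a, sub_nonpos.2 ha⟩ ⟨b, sub_nonneg.2 hb⟩
      exact hex t (sub_eq_zero.1 ht)
    have hstep : ∀ j : ℕ, ((j + 1 : ℕ) : ℝ) * τ = j * τ + τ := fun j => by push_cast; ring
    rcases hsign with hs | hs
    · have hm : StrictMono fun j : ℕ => W (j * τ) := strictMono_nat_of_lt_succ fun j => by
        rw [hstep]; exact hs _
      have := hm hk
      simp only [Nat.cast_zero, zero_mul] at this
      exact this.ne' h
    · have hm : StrictAnti fun j : ℕ => W (j * τ) := strictAnti_nat_of_succ_lt fun j => by
        rw [hstep]; exact hs _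
      have := hm hk
      simp only [Nat.cast_zero, zero_mul] at this
      exact this.ne h

/-- On a compact part of the period annulus `1 / H` ranges in a compact part of `(1, ∞)`. -/
lemma exists_Icc_of_isCompact {K : Set (ℝ × ℝ)} (hK : IsCompact K) (hKA : K ⊆ periodAnnulus) :
    ∃ α β : ℝ, 1 < α ∧ ∀ p ∈ K, p.1 ^ 2 + p.2 ^ 2 ≠ 0 ∧
      (1 + 2 * p.1 * p.2) / (p.1 ^ 2 + p.2 ^ 2) ∈ Icc α β := by
  have h1 : ∀ p ∈ K, p.1 ^ 2 + p.2 ^ 2 ≠ 0 ∧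
      1 < (1 + 2 * p.1 * p.2) / (p.1 ^ 2 + p.2 ^ 2) := by
    intro p hp
    obtain ⟨h, hh, hpH⟩ := mem_iUnion₂.1 (hKA hp)
    have hpH : (p.1 ^ 2 + p.2 ^ 2) / (1 + 2 * p.1 * p.2) = h := hpH
    refine ⟨fun h0 => ?_, ?_⟩
    · rw [h0, zero_div] at hpH
      exact hh.1.ne hpH
    · rw [← inv_div, hpH]
      exact (one_lt_inv₀ hh.1).2 hh.2
  rcases K.eq_empty_or_nonempty with rfl | hne
  · exact ⟨2, 2, by norm_num, by simp⟩
  have hc : ContinuousOn (fun p : ℝ × ℝ => (1 + 2 * p.1 * p.2) / (p.1 ^ 2 + p.2 ^ 2)) K :=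
    ContinuousOn.div (by fun_prop) (by fun_prop) fun p hp => (h1 p hp).1
  obtain ⟨p, hp, hpmin⟩ := hK.exists_isMinOn hne hc
  obtain ⟨q, hq, hqmax⟩ := hK.exists_isMaxOn hne hc
  exact ⟨_, _, (h1 p hp).2, fun r hr => ⟨(h1 r hr).1, hpmin hr, hqmax hr⟩⟩

/-- If there are `m` periodic orbits in `K`, then the function `D`, which vanishes at the
initial values of the `2π`-periodic solutions of the scalar equation, has `m` distinct zeros. -/
lemma exists_injective_zeros {f g : MvPolynomial (Fin 2) ℝ} {ε α β : ℝ} {D : ℂ → ℂ} {L : ℝ}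
    (hα : 1 < α)
    (hA : ∀ t, ∀ x ∈ Icc α β, ‖(ε : ℂ) * complexAngularPart f g t (x : ℂ)‖ ≤ 1 / 2)
    (hL : ∀ t, ∀ x ∈ Icc α β, ∀ y ∈ Icc α β,
      ‖(ε : ℂ) * complexRadialPart f g t (x : ℂ) / (1 + (ε : ℂ) * complexAngularPart f g t (x : ℂ))
        - (ε : ℂ) * complexRadialPart f g t (y : ℂ)
          / (1 + (ε : ℂ) * complexAngularPart f g t (y : ℂ))‖ ≤ L * |x - y|)
    (hD : ∀ W : ℝ → ℝ, (∀ t, W t ∈ Icc α β ∧ HasDerivAt (fun t => (W t : ℂ))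
      ((ε : ℂ) * complexRadialPart f g t (W t)
        / (1 + (ε : ℂ) * complexAngularPart f g t (W t))) t) →
      W (2 * Real.pi) = W 0 → D (W 0) = 0)
    {K : Set (ℝ × ℝ)}
    (hK : ∀ p ∈ K, p.1 ^ 2 + p.2 ^ 2 ≠ 0 ∧
      (1 + 2 * p.1 * p.2) / (p.1 ^ 2 + p.2 ^ 2) ∈ Icc α β)
    {m : ℕ} {C : Fin m → Set (ℝ × ℝ)} (hCinj : Function.Injective C)
    (hC : ∀ i, IsPeriodicOrbit (field f g ε) (C i) ∧ C i ⊆ K) :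
    ∃ x : Fin m → ℝ, Function.Injective x ∧ ∀ i, x i ∈ Icc α β ∧ D (x i) = 0 := by
  set F : ℝ → ℝ → ℝ := fun t w => ε * radialPart f g t w / (1 + ε * angularPart f g t w) with hF
  have hFc : ∀ t, ∀ w ∈ Icc α β, (ε : ℂ) * complexRadialPart f g t (w : ℂ)
      / (1 + (ε : ℂ) * complexAngularPart f g t (w : ℂ)) = (F t w : ℂ) := by
    intro t w hw
    have hw1 : 1 < w := hα.trans_le hw.1
    rw [complexRadialPart_ofReal f g hw1, complexAngularPart_ofReal f g hw1, hF]
    push_cast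
    rfl
  have hFL : ∀ t, LipschitzOnWith L.toNNReal (F t) (Icc α β) := by
    intro t
    refine LipschitzOnWith.of_dist_le_mul fun x hx y hy => ?_
    have h1 := hL t x hx y hy
    rw [hFc t x hx, hFc t y hy, ← Complex.ofReal_sub, Complex.norm_real] at h1
    rw [Real.dist_eq, Real.dist_eq]
    exact h1.trans (mul_le_mul_of_nonneg_right (Real.le_coe_toNNReal L) (abs_nonneg _))
  have hFp : Function.Periodic F (2 * Real.pi) := fun t => by
    simp only [hF, periodic_angularPart f g t, periodic_radialPart f g t]
  have hA' : ∀ t, ∀ w ∈ Icc α β, |ε * angularPart f g t w| ≤ 1 / 2 := fun t w hw => by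
    have h1 := hA t w hw
    rwa [complexAngularPart_ofReal f g (hα.trans_le hw.1), ← Complex.ofReal_mul,
      Complex.norm_real] at h1
  choose W hW hret hrange using fun i =>
    exists_graph_of_isPeriodicOrbit f g hK hA' (hC i).1 (hC i).2
  have hW' : ∀ i t, HasDerivAt (W i) (F t (W i t)) t ∧ W i t ∈ Icc α β := fun i t =>
    ⟨(hW i t).2, (hW i t).1⟩
  refine ⟨fun i => W i 0, fun i j hij => hCinj ?_, fun i => ⟨(hW i 0).1, ?_⟩⟩
  · have h1 : W i = W j :=
      ODE_solution_unique_univ (s := fun _ => Icc α β) hFL (hW' i) (hW' j) hij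
    rw [hrange i, hrange j, h1]
  · obtain ⟨k, hk, hkW⟩ := hret i
    refine hD (W i) (fun t => ⟨(hW i t).1, ?_⟩) (eq_of_return hFp hFL (hW' i) hk hkW)
    rw [hFc t _ (hW i t).1]
    exact (hW i t).2.ofReal_comp

lemma exists_injective_fin_of_encard_lt {ι : Type*} {s : Set ι} {N : ℕ} (h : (N : ℕ∞) < s.encard) :
    ∃ C : Fin (N + 1) → ι, Function.Injective C ∧ ∀ i, C i ∈ s := by
  obtain ⟨t, hts, ht⟩ := exists_subset_encard_eq (k := ((N + 1 : ℕ) : ℕ∞))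
    (by push_cast; exact Order.add_one_le_of_lt h)
  have hfin : t.Finite := finite_of_encard_eq_coe ht
  have hcard : hfin.toFinset.card = N + 1 := by
    rw [hfin.encard_eq_coe_toFinset_card] at ht
    exact_mod_cast ht
  refine ⟨fun i => ((hfin.toFinset.equivFinOfCardEq hcard).symm i : ι), fun i j hij =>
    (hfin.toFinset.equivFinOfCardEq hcard).symm.injective (Subtype.ext hij), fun i => hts ?_⟩
  exact hfin.mem_toFinset.1 ((hfin.toFinset.equivFinOfCardEq hcard).symm i).2

end CubicIsochronous

open CubicIsochronous Filter Topology in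
theorem theorem1p1 (n : ℕ) (hn : 1 ≤ n) (f g : MvPolynomial (Fin 2) ℝ)
    (hf : f.totalDegree ≤ n) (hg : g.totalDegree ≤ n)
    (hI : ∃ h ∈ Set.Ioo (0 : ℝ) 1, CubicIsochronous.abelianIntegral f g h ≠ 0) :
    CubicIsochronous.AtMostLimitCyclesBifurcate (CubicIsochronous.field f g)
      CubicIsochronous.periodAnnulus (4 * ((n + 1) / 2) + 1) := by
  intro K hK hKA
  set J := (n + 1) / 2 with hJ
  obtain ⟨α, β, hα, hKαβ⟩ := exists_Icc_of_isCompact hK hKA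
  obtain ⟨U, C, ε₁, D, hU, hαU, hU1, hε₁, hD⟩ := exists_averaging
    (continuousOn_complexAngularPart f g) (continuousOn_complexRadialPart f g)
    (differentiableOn_complexAngularPart f g) (differentiableOn_complexRadialPart f g)
    (periodic_complexAngularPart f g) (periodic_complexRadialPart f g) (β := β) hα
  by_contra! hcon
  -- too many zeros of the difference functions along a sequence `ε k → 0`
  have hseq : ∀ k : ℕ, ∃ ε : ℝ, 0 < |ε| ∧ |ε| < ε₁ ∧ |ε| < 1 / ((k : ℝ) + 1) ∧
      ∃ x : Fin (4 * J + 1 + 1) → ℝ, Function.Injective x ∧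
        ∀ i, x i ∈ Set.Icc α β ∧ D ε (x i) = 0 := by
    intro k
    obtain ⟨ε, hε0, hε, hcard⟩ := hcon (min ε₁ (1 / ((k : ℝ) + 1))) (by positivity)
    have hε1 := hε.trans_le (min_le_left _ _)
    obtain ⟨S, hSinj, hS⟩ := exists_injective_fin_of_encard_lt hcard
    obtain ⟨h1, ⟨L, h2⟩, -, -, h3⟩ := hD ε hε0 hε1
    exact ⟨ε, hε0, hε1, hε.trans_le (min_le_right _ _),
      exists_injective_zeros hα h1 h2 h3 hKαβ hSinj fun i => ⟨(hS i).1.1, (hS i).2⟩⟩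
  choose ε hε0 hε1 hεk x hxinj hx using hseq
  obtain ⟨c, hc, φ, hφ, hlim⟩ := (isCompact_univ_pi fun _ : Fin (4 * J + 1 + 1) =>
    isCompact_Icc (a := α) (b := β)).tendsto_subseq (x := x) fun k i _ => (hx k i).1
  set M : ℂ → ℂ := fun w => ∫ t in (0 : ℝ)..(2 * Real.pi), complexRadialPart f g t w with hM
  have hεlim : Tendsto (fun k => C * |ε (φ k)|) atTop (𝓝 0) := by
    have h1 : Tendsto (fun k => |ε k|) atTop (𝓝 0) :=
      squeeze_zero (fun k => abs_nonneg _) (fun k => (hεk k).le)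
        tendsto_one_div_add_atTop_nhds_zero_nat
    simpa using (h1.comp hφ.tendsto_atTop).const_mul C
  have hunif : TendstoLocallyUniformlyOn (fun k => D (ε (φ k))) M atTop U := by
    refine TendstoUniformlyOn.tendstoLocallyUniformlyOn ?_
    rw [Metric.tendstoUniformlyOn_iff]
    intro δ hδ
    filter_upwards [hεlim.eventually (gt_mem_nhds hδ)] with k hk w hw
    rw [dist_comm, dist_eq_norm]
    exact ((hD _ (hε0 _) (hε1 _)).2.2.2.1 w hw).trans_lt hk
  have hcαβ : ∀ i, c i ∈ Set.Icc α β := fun i => hc i trivial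
  obtain ⟨G, hG, hMG⟩ := exists_eq_prod_mul_of_tendsto_zeros hU
    (fun k => (hD _ (hε0 (φ k)) (hε1 (φ k))).2.2.1) hunif
    (x := fun k i => (x (φ k) i : ℂ)) (c := fun i => (c i : ℂ))
    (fun i => hαU _ (hcαβ i)) (fun k i => hαU _ (hx _ i).1)
    (fun i => (Complex.continuous_ofReal.tendsto _).comp ((tendsto_pi_nhds.1 hlim) i))
    (fun k => Complex.ofReal_injective.comp (hxinj (φ k))) (fun k i => (hx _ i).2)
  -- the averaged function is not identically zero and has too many zeros
  have hMreal : ∀ w : ℝ, 1 < w →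
      M w = ((∫ t in (0 : ℝ)..(2 * Real.pi), radialPart f g t w : ℝ) : ℂ) := fun w hw => by
    simp only [hM, complexRadialPart_ofReal f g hw]
    exact intervalIntegral.integral_ofReal
  have hne : ∃ w : ℝ, 1 < w ∧ (w ^ 2 - 1) ^ (J - 1) *
      ∫ t in (0 : ℝ)..(2 * Real.pi), radialPart f g t w ≠ 0 := by
    obtain ⟨h, hh, hne⟩ := hI
    have hw : 1 < 1 / h := one_lt_one_div hh.1 hh.2
    rw [abelianIntegral_eq f g hh] at hne
    exact ⟨1 / h, hw, mul_ne_zero (pow_ne_zero _ (by nlinarith)) (right_ne_zero_of_mul hne)⟩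
  have hSo : IsOpen ((fun w : ℝ => (w : ℂ)) ⁻¹' U) := hU.preimage Complex.continuous_ofReal
  have hS1 : (fun w : ℝ => (w : ℂ)) ⁻¹' U ⊆ Set.Ioi 1 := fun w hw => by
    simpa using hU1 hw
  have hle := (isSqrtPoly_integral_radialPart (J := J) f g hf hg (by omega)
    (by omega)).card_zeros_le hne hSo hS1 (c := c) (fun i => hαU _ (hcαβ i))
    (g := fun w : ℝ => ((w : ℂ) ^ 2 - 1) ^ (J - 1) * G w)
    (by
      have h1 : ContinuousOn (fun w : ℝ => G w) ((fun w : ℝ => (w : ℂ)) ⁻¹' U) :=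
        hG.comp Complex.continuous_ofReal.continuousOn fun _ hw => hw
      exact (((Complex.continuous_ofReal.pow 2).sub continuous_const).pow _).continuousOn.mul h1)
    fun w hw => by
      have h1 := hMG w hw
      rw [hMreal w (hS1 hw)] at h1
      push_cast
      rw [h1]
      ring
  omega
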